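/- Let $n\ge 2$ be an integer, let $p>n$ be real, and set $$\beta_p:=-\frac13+\frac{2}{3(p-1)}+\sqrt{\left(-\frac13+\frac{2}{3(p-1)}\right)^2+\frac13}.$$ Let $\beta<\beta_p$ be real, and let $u\ge 0$ be a continuous real-valued function on $\{x\in\mathbb{R}^n : x_n\ge 0,\ x\ne 0\}$ which is $p$-harmonic in the open half-space $\Omega=\{x_n>0\}$, i.e. $\Delta_p u=\nabla\cdot(|\nabla u|^{p-2}\nabla u)=0$ in the weak sense: $u\in W^{1,p}_{\mathrm{loc}}(\Omega)$ and $\int_\Omega |\nabla u|^{p-2}\,\nabla u\cdot\nabla\varphi\,dx=0$ for all $\varphi\in C_c^\infty(\Omega)$. Suppose that $u(x)=0$ whenever $x_n=0$ and $x\neq 0$, that $|u(x)|\le 1$ whenever $x_n\ge 0$ and $|x|\ge 1$, and that $$|u(x)|\le |x|^{-\beta}\qquad\text{whenever } x_n\ge 0 \text{ and } 0<|x|\le 1.$$ Then $|u(x)|\le 1$ for all $x\neq 0$ with $x_n\ge 0$. -/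

import Mathlib

open MeasureTheory
open scoped ContDiff

noncomputable section

/-- The last index of `Fin n`, so that `x (lastIdx n hn)` is the coordinate `x_n` of `x ∈ ℝⁿ`. -/
def lastIdx (n : ℕ) (hn : 2 ≤ n) : Fin n := ⟨n - 1, by omega⟩

/-- The open upper half-space `{x ∈ ℝⁿ : x_n > 0}`. -/
def upperHalf (n : ℕ) (hn : 2 ≤ n) : Set (EuclideanSpace ℝ (Fin n)) :=
  {x | 0 < x (lastIdx n hn)}

/-- The closed upper half-space with the origin removed, `{x ∈ ℝⁿ : x_n ≥ 0, x ≠ 0}`. -/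
def closedUpperHalfPunctured (n : ℕ) (hn : 2 ≤ n) : Set (EuclideanSpace ℝ (Fin n)) :=
  {x | 0 ≤ x (lastIdx n hn) ∧ x ≠ 0}

/-- Test functions `φ ∈ C_c^∞(Ω)`. -/
structure IsTestFunction {n : ℕ} (Ω : Set (EuclideanSpace ℝ (Fin n)))
    (φ : EuclideanSpace ℝ (Fin n) → ℝ) : Prop where
  smooth : ContDiff ℝ ∞ φ
  compactSupport : HasCompactSupport φ
  tsupport_subset : tsupport φ ⊆ Ω

/-- `f ∈ L^p_loc(Ω)`, for a real exponent `p`: `f ∈ L^p(K)` for every compact `K ⊆ Ω`. -/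
def MemLpLoc {n : ℕ} {F : Type*} [NormedAddCommGroup F] (p : ℝ)
    (Ω : Set (EuclideanSpace ℝ (Fin n))) (f : EuclideanSpace ℝ (Fin n) → F) : Prop :=
  ∀ K : Set (EuclideanSpace ℝ (Fin n)), IsCompact K → K ⊆ Ω →
    MemLp f (ENNReal.ofReal p) (volume.restrict K)

/-- `G` is the weak (distributional) gradient of `u` in the open set `Ω`: both are locally
integrable and `∫_Ω u ∂_v φ = - ∫_Ω ⟨G, v⟩ φ` for every direction `v` and test function `φ`. -/
structure IsWeakGradient {n : ℕ} (Ω : Set (EuclideanSpace ℝ (Fin n)))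
    (u : EuclideanSpace ℝ (Fin n) → ℝ)
    (G : EuclideanSpace ℝ (Fin n) → EuclideanSpace ℝ (Fin n)) : Prop where
  locInt : MemLpLoc 1 Ω u
  locInt_grad : MemLpLoc 1 Ω G
  integral_eq : ∀ φ : EuclideanSpace ℝ (Fin n) → ℝ, IsTestFunction Ω φ →
    ∀ v : EuclideanSpace ℝ (Fin n),
      ∫ x in Ω, u x * fderiv ℝ φ x v = - ∫ x in Ω, inner ℝ (G x) v * φ x

/-- `u` is `p`-harmonic in the open set `Ω`, that is `Δ_p u = div (|∇u|^{p-2} ∇u) = 0` in the weak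
sense: `u ∈ W^{1,p}_loc(Ω)` and `∫_Ω |∇u|^{p-2} ⟨∇u, ∇φ⟩ = 0` for every test function `φ`. -/
def IsPHarmonic {n : ℕ} (p : ℝ) (Ω : Set (EuclideanSpace ℝ (Fin n)))
    (u : EuclideanSpace ℝ (Fin n) → ℝ) : Prop :=
  ∃ G : EuclideanSpace ℝ (Fin n) → EuclideanSpace ℝ (Fin n),
    IsWeakGradient Ω u G ∧ MemLpLoc p Ω u ∧ MemLpLoc p Ω G ∧
    ∀ φ : EuclideanSpace ℝ (Fin n) → ℝ, IsTestFunction Ω φ →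
      ∫ x in Ω, ‖G x‖ ^ (p - 2) * inner ℝ (G x) (gradient φ x) = 0

/-- The exponent `β_p = -1/3 + 2/(3(p-1)) + √((-1/3 + 2/(3(p-1)))² + 1/3)`. -/
def betaExp (p : ℝ) : ℝ :=
  -(1 / 3) + 2 / (3 * (p - 1)) + √((-(1 / 3) + 2 / (3 * (p - 1))) ^ 2 + 1 / 3)

end

/-!
The function `u` is compared with `1 + εV`, where `V` is a positive `p`-harmonic function in the
half-space which grows at least like `|x|^{-b}` near the origin, `max β 0 < b < β_p`.

*The barrier* (`exists_barrier`). Separated functions `r^{-b} f(θ)` of the first and last coordinates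
`(x_0, x_n)` are `p`-harmonic when `s = -f'/f` solves the autonomous Riccati type equation
`s' = riccatiRate p b s`. Partial fractions integrate it explicitly (`riccatiAngle`), and its odd
solution lives on an interval strictly larger than `[-π/2, π/2]` precisely when `b < β_p`
(`four_mul_riccatiConst_lt`). Thus `f` is bounded below by a positive constant on the half-plane,
flat boundary included. In dimension `n > 2` the function is constant in the other variables, so
it is singular on all of `x_0 = x_n = 0`; this is harmless because it is large there and
`|(x_0, x_n)| ≤ |x|` keeps the lower bound by `|x|^{-b}`.

*The contact set* (`isCompact_contact_set`). Where `1 + εV ≤ u` one has `|x| ≤ 1`, and `|x|` is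
bounded below since `b > β`; as `u` vanishes on the flat boundary, this set is a compact subset of
the open half-space.

*Comparison* (`IsPHarmonic.le_of_isCompact`). With `h = u - (1 + εV)` the function `ψ(h)`, `ψ`
smooth, nondecreasing and supported in `[0, ∞)`, is an admissible test function after
mollification of `h`. Monotonicity of `a ↦ |a|^{p-2} a` gives `ψ'(h) ∇h = 0`, that is
`∇(ψ(h)) = 0`, and integration against a coordinate function yields `∫ ψ(h) = 0`, hence `h ≤ 0`.
Mollification in `L^p` rests on `eLpNorm_normed_convolution_le`. Finally `ε → 0`.
-/

noncomputable section

open Filter Topology Metric Set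
open scoped ENNReal Convolution

/-! ### Mollification in `L^q` -/

section Mollification

variable {E F : Type*} [NormedAddCommGroup E] [InnerProductSpace ℝ E] [FiniteDimensional ℝ E]
  [MeasurableSpace E] [BorelSpace E] [NormedAddCommGroup F] [NormedSpace ℝ F]

/-- Mollification does not increase the `L^q` norm: Jensen's inequality for the probability
measure with density `φ`, followed by Tonelli's theorem. -/
theorem eLpNorm_normed_convolution_le (φ : ContDiffBump (0 : E)) {f : E → F} {q : ℝ≥0∞}
    (hq : 1 ≤ q) (hq' : q ≠ ⊤) (hf : AEStronglyMeasurable f volume) :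
    eLpNorm (φ.normed volume ⋆[ContinuousLinearMap.lsmul ℝ ℝ, volume] f) q volume
      ≤ eLpNorm f q volume := by
  set r : ℝ := q.toReal with hr
  have hr1 : 1 ≤ r := by
    rw [hr, ← ENNReal.toReal_one]; exact ENNReal.toReal_mono hq' hq
  have hr0 : 0 < r := by linarith
  set w : E → ℝ≥0∞ := fun t => ENNReal.ofReal (φ.normed volume t) with hw
  have hwm : Measurable w := (φ.contDiff_normed (n := 0)).continuous.measurable.ennreal_ofReal
  set ν : Measure E := volume.withDensity w with hν
  have hνp : IsProbabilityMeasure ν := by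
    constructor
    rw [hν, withDensity_apply _ MeasurableSet.univ, Measure.restrict_univ, hw,
      ← ofReal_integral_eq_lintegral_ofReal φ.integrable_normed
        (Eventually.of_forall φ.nonneg_normed), φ.integral_normed, ENNReal.ofReal_one]
  have hac : ν ≪ volume := withDensity_absolutelyContinuous _ _
  have hmeas : ∀ x : E, AEStronglyMeasurable (fun t => f (x - t)) volume := fun x =>
    hf.comp_quasiMeasurePreserving (quasiMeasurePreserving_sub_left volume x)
  -- Jensen's inequality at a point
  have hpt : ∀ x, ‖(φ.normed volume ⋆[ContinuousLinearMap.lsmul ℝ ℝ, volume] f) x‖ₑ ^ r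
      ≤ ∫⁻ t, w t * ‖f (x - t)‖ₑ ^ r := by
    intro x
    have h1 : ‖(φ.normed volume ⋆[ContinuousLinearMap.lsmul ℝ ℝ, volume] f) x‖ₑ
        ≤ ∫⁻ t, ‖f (x - t)‖ₑ ∂ν := by
      rw [convolution_def, hν, lintegral_withDensity_eq_lintegral_mul₀ hwm.aemeasurable
        (hmeas x).enorm]
      refine (enorm_integral_le_lintegral_enorm _).trans (lintegral_mono fun t => ?_)
      simp only [ContinuousLinearMap.lsmul_apply, enorm_smul, Pi.mul_apply, hw]
      rw [Real.enorm_eq_ofReal (φ.nonneg_normed t)]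
    have h2 := eLpNorm'_le_eLpNorm'_of_exponent_le zero_lt_one hr1 ν ((hmeas x).mono_ac hac)
    simp only [eLpNorm', ENNReal.rpow_one, div_one] at h2
    calc _ ≤ ((∫⁻ t, ‖f (x - t)‖ₑ ^ r ∂ν) ^ (1 / r)) ^ r := by
          gcongr; exact h1.trans h2
      _ = ∫⁻ t, ‖f (x - t)‖ₑ ^ r ∂ν := by
          rw [← ENNReal.rpow_mul, one_div_mul_cancel hr0.ne', ENNReal.rpow_one]
      _ = _ := by
          rw [hν, lintegral_withDensity_eq_lintegral_mul₀ hwm.aemeasurable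
            ((hmeas x).enorm.pow_const r)]
          rfl
  have hq0 : q ≠ 0 := by rintro rfl; simp at hq
  rw [eLpNorm_eq_lintegral_rpow_enorm_toReal hq0 hq', eLpNorm_eq_lintegral_rpow_enorm_toReal hq0 hq']
  refine ENNReal.rpow_le_rpow ?_ (by positivity)
  have hjoint : AEMeasurable (fun z : E × E => w z.2 * ‖f (z.1 - z.2)‖ₑ ^ r)
      (volume.prod volume) := by
    refine (hwm.comp measurable_snd).aemeasurable.mul ?_
    exact (hf.comp_quasiMeasurePreserving
      (quasiMeasurePreserving_sub_of_right_invariant volume volume)).enorm.pow_const r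
  calc _ ≤ ∫⁻ x, ∫⁻ t, w t * ‖f (x - t)‖ₑ ^ r := lintegral_mono hpt
    _ = ∫⁻ t, ∫⁻ x, w t * ‖f (x - t)‖ₑ ^ r := lintegral_lintegral_swap hjoint
    _ = ∫⁻ t, w t * ∫⁻ x, ‖f x‖ₑ ^ r := by
        refine lintegral_congr fun t => ?_
        rw [lintegral_const_mul' _ _ ENNReal.ofReal_ne_top,
          lintegral_sub_right_eq_self (fun x => ‖f x‖ₑ ^ r) t]
    _ = ν univ * ∫⁻ x, ‖f x‖ₑ ^ r := by
        rw [lintegral_mul_const _ hwm, hν, withDensity_apply _ MeasurableSet.univ,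
          Measure.restrict_univ]
    _ = _ := by rw [measure_univ, one_mul]

/-- Mollifications of an `L^q` function converge to it in `L^q(K)`, `K` compact. -/
theorem exists_eLpNorm_normed_convolution_sub_le [CompleteSpace F] {f : E → F} {q : ℝ≥0∞}
    (hq : 1 ≤ q) (hq' : q ≠ ⊤) (hf : MemLp f q volume) {K : Set E} (hK : IsCompact K)
    {ε : ℝ≥0∞} (hε : ε ≠ 0) :
    ∃ δ > 0, ∀ φ : ContDiffBump (0 : E), φ.rOut ≤ δ →
      eLpNorm (φ.normed volume ⋆[ContinuousLinearMap.lsmul ℝ ℝ, volume] f - f) q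
        (volume.restrict K) ≤ ε := by
  have hε3 : ε / 3 ≠ 0 := by simp [hε]
  obtain ⟨g, hgs, hfg, hgc, hgm⟩ := hf.exists_hasCompactSupport_eLpNorm_sub_le hq' hε3
  obtain ⟨η, hη, hηε⟩ : ∃ η : ℝ, 0 < η ∧
      (volume.restrict K) univ ^ q.toReal⁻¹ * ENNReal.ofReal η ≤ ε / 3 := by
    have hfin : (volume.restrict K) univ ^ q.toReal⁻¹ ≠ ⊤ := by
      simp only [Measure.restrict_apply_univ]
      exact (ENNReal.rpow_lt_top_of_nonneg (by positivity) hK.measure_lt_top.ne).ne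
    have ht : Tendsto (fun η : ℝ => (volume.restrict K) univ ^ q.toReal⁻¹ * ENNReal.ofReal η)
        (𝓝[>] 0) (𝓝 0) := by
      have := ENNReal.Tendsto.const_mul (a := (volume.restrict K) univ ^ q.toReal⁻¹)
        (ENNReal.tendsto_ofReal (tendsto_id (α := ℝ) (x := 𝓝 0))) (Or.inr hfin)
      simp only [ENNReal.ofReal_zero, mul_zero, id] at this
      exact this.mono_left nhdsWithin_le_nhds
    have h := (ht.eventually (ge_mem_nhds (pos_iff_ne_zero.2 hε3))).and self_mem_nhdsWithin
    obtain ⟨η, h1, h2⟩ := h.exists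
    exact ⟨η, h2, h1⟩
  obtain ⟨δ, hδ, hgδ⟩ := Metric.uniformContinuous_iff.1
    (hgs.uniformContinuous_of_continuous hgc) η hη
  refine ⟨δ, hδ, fun φ hφ => ?_⟩
  set A := φ.normed volume ⋆[ContinuousLinearMap.lsmul ℝ ℝ, volume] f
  set B := φ.normed volume ⋆[ContinuousLinearMap.lsmul ℝ ℝ, volume] g
  have hfl : LocallyIntegrable f volume := hf.locallyIntegrable hq
  have hgl : LocallyIntegrable g volume := hgm.locallyIntegrable hq
  have hφc : Continuous (φ.normed volume) := (φ.contDiff_normed (n := 0)).continuous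
  have hφs : HasCompactSupport (φ.normed volume) := φ.hasCompactSupport_normed
  have hex : ∀ {k : E → F}, LocallyIntegrable k volume →
      ConvolutionExists (φ.normed volume) k (ContinuousLinearMap.lsmul ℝ ℝ) volume := fun hk =>
    hφs.convolutionExists_left _ hφc hk
  have hA : AEStronglyMeasurable A (volume.restrict K) :=
    (hφs.continuous_convolution_left _ hφc hfl).aestronglyMeasurable
  have hB : AEStronglyMeasurable B (volume.restrict K) :=
    (hφs.continuous_convolution_left _ hφc hgl).aestronglyMeasurable
  have hAB : eLpNorm (A - B) q (volume.restrict K) ≤ ε / 3 := by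
    have : A - B = φ.normed volume ⋆[ContinuousLinearMap.lsmul ℝ ℝ, volume] (f - g) := by
      have h := (hex (hfl.sub hgl)).distrib_add (hex hgl)
      rw [sub_add_cancel] at h
      rw [sub_eq_iff_eq_add]; exact h
    rw [this]
    exact (eLpNorm_mono_measure _ Measure.restrict_le_self).trans
      ((eLpNorm_normed_convolution_le φ hq hq' (hf.1.sub hgm.1)).trans hfg)
  have hBg : eLpNorm (B - g) q (volume.restrict K) ≤ ε / 3 := by
    refine (eLpNorm_le_of_ae_bound (C := η) (Eventually.of_forall fun x => ?_)).trans hηε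
    rw [Pi.sub_apply, ← dist_eq_norm]
    refine ContDiffBump.dist_normed_convolution_le hgm.1 fun y hy => ?_
    exact (hgδ (lt_of_lt_of_le (mem_ball.1 hy) hφ)).le
  have hgf : eLpNorm (g - f) q (volume.restrict K) ≤ ε / 3 := by
    rw [eLpNorm_sub_comm]
    exact (eLpNorm_mono_measure _ Measure.restrict_le_self).trans hfg
  calc eLpNorm (A - f) q (volume.restrict K)
      = eLpNorm ((A - B) + ((B - g) + (g - f))) q (volume.restrict K) := by congr 1; abel
    _ ≤ eLpNorm (A - B) q (volume.restrict K) + (eLpNorm (B - g) q (volume.restrict K)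
        + eLpNorm (g - f) q (volume.restrict K)) := by
        refine (eLpNorm_add_le (hA.sub hB) ((hB.sub hgm.1.restrict).add
          (hgm.1.restrict.sub hf.1.restrict)) hq).trans ?_
        gcongr
        exact eLpNorm_add_le (hB.sub hgm.1.restrict) (hgm.1.restrict.sub hf.1.restrict) hq
    _ ≤ ε / 3 + (ε / 3 + ε / 3) := by gcongr
    _ = ε := by rw [← add_assoc, ENNReal.add_thirds]

end Mollification

/-! ### Smooth approximation of Sobolev functions -/

theorem MemLpLoc.integrable_indicator {n : ℕ} {F : Type*} [NormedAddCommGroup F]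
    {Ω K : Set (EuclideanSpace ℝ (Fin n))} {f : EuclideanSpace ℝ (Fin n) → F}
    (hf : MemLpLoc 1 Ω f) (hK : IsCompact K) (hKΩ : K ⊆ Ω) :
    Integrable (K.indicator f) volume := by
  have := hf K hK hKΩ
  rw [ENNReal.ofReal_one] at this
  exact (integrable_indicator_iff hK.measurableSet).2 (memLp_one_iff_integrable.1 this)

/-- At points of `K` whose distance to the complement exceeds the mollification radius, the gradient of the
mollification is the mollification of the weak gradient. -/
theorem IsWeakGradient.gradient_normed_convolution {n : ℕ} {Ω : Set (EuclideanSpace ℝ (Fin n))}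
    {h : EuclideanSpace ℝ (Fin n) → ℝ}
    {H : EuclideanSpace ℝ (Fin n) → EuclideanSpace ℝ (Fin n)} (hH : IsWeakGradient Ω h H)
    {K : Set (EuclideanSpace ℝ (Fin n))} (hK : IsCompact K) (hKΩ : K ⊆ Ω)
    (φ : ContDiffBump (0 : EuclideanSpace ℝ (Fin n))) {x : EuclideanSpace ℝ (Fin n)}
    (hx : closedBall x φ.rOut ⊆ K) :
    gradient (φ.normed volume ⋆[ContinuousLinearMap.lsmul ℝ ℝ, volume] K.indicator h) x
      = (φ.normed volume ⋆[ContinuousLinearMap.lsmul ℝ ℝ, volume] K.indicator H) x := by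
  set ρ : EuclideanSpace ℝ (Fin n) → ℝ := φ.normed volume with hρ
  have hρc : ContDiff ℝ ∞ ρ := φ.contDiff_normed
  have hρs : HasCompactSupport ρ := φ.hasCompactSupport_normed
  have hρt : ∀ y, y ∉ closedBall x φ.rOut → ρ (x - y) = 0 := by
    intro y hy
    by_contra h0
    have : x - y ∈ Function.support ρ := h0
    rw [hρ, φ.support_normed_eq, mem_ball, dist_zero_right] at this
    exact hy (by rw [mem_closedBall, dist_comm, dist_eq_norm]; exact this.le)
  have hdρt : ∀ y, y ∉ closedBall x φ.rOut → fderiv ℝ ρ (x - y) = 0 := by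
    intro y hy
    by_contra h0
    have : x - y ∈ tsupport ρ := support_fderiv_subset ℝ h0
    rw [hρ, φ.tsupport_normed_eq, mem_closedBall, dist_zero_right] at this
    exact hy (by rw [mem_closedBall, dist_comm, dist_eq_norm]; exact this)
  have hint : Integrable (K.indicator h) volume :=
    hH.locInt.integrable_indicator hK hKΩ
  have hintH : Integrable (K.indicator H) volume :=
    hH.locInt_grad.integrable_indicator hK hKΩ
  have htest : IsTestFunction Ω (fun y => ρ (x - y)) := by
    have hsub : tsupport (fun y => ρ (x - y)) ⊆ closedBall x φ.rOut := by
      refine closure_minimal (fun y hy => ?_) isClosed_closedBall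
      by_contra h0
      exact hy (hρt y h0)
    exact ⟨hρc.comp (contDiff_const.sub contDiff_id),
      HasCompactSupport.of_support_subset_isCompact (isCompact_closedBall x φ.rOut)
        (subset_closure.trans hsub), hsub.trans (hx.trans hKΩ)⟩
  have hfd : ∀ y v, fderiv ℝ (fun y => ρ (x - y)) y v = - fderiv ℝ ρ (x - y) v := by
    intro y v
    have h1 : HasFDerivAt (fun y => x - y) (-ContinuousLinearMap.id ℝ _) y :=
      (hasFDerivAt_id y).const_sub x
    have h2 := ((hρc.differentiable (by simp)).differentiableAt
      (x := x - y)).hasFDerivAt.comp y h1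
    have h3 : fderiv ℝ (fun y => ρ (x - y)) y = _ := h2.fderiv
    rw [h3]; simp
  have hD := hρs.hasFDerivAt_convolution_left (ContinuousLinearMap.lsmul ℝ ℝ)
    (hρc.of_le (by simp)) hint.locallyIntegrable x
  refine ext_inner_right ℝ fun v => ?_
  rw [inner_gradient_left, hD.fderiv, convolution_eq_swap, convolution_eq_swap,
    ContinuousLinearMap.integral_apply]
  · have e1 : ∀ y, ((ContinuousLinearMap.precompL (EuclideanSpace ℝ (Fin n))
        (ContinuousLinearMap.lsmul ℝ ℝ) (fderiv ℝ ρ (x - y))) (K.indicator h y)) v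
        = - Ω.indicator (fun y => h y * fderiv ℝ (fun y => ρ (x - y)) y v) y := by
      intro y
      rw [ContinuousLinearMap.precompL_apply, ContinuousLinearMap.lsmul_apply, smul_eq_mul]
      by_cases hy : y ∈ K
      · rw [indicator_of_mem hy, indicator_of_mem (hKΩ hy), hfd]; ring
      · have h0 : fderiv ℝ ρ (x - y) = 0 := hdρt y fun h' => hy (hx h')
        by_cases hyΩ : y ∈ Ω
        · rw [indicator_of_mem hyΩ, hfd, h0]; simp
        · rw [indicator_of_notMem hyΩ, h0]; simp
    have e2 : ∀ y, inner ℝ v ((ContinuousLinearMap.lsmul ℝ ℝ (ρ (x - y))) (K.indicator H y))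
        = Ω.indicator (fun y => inner ℝ (H y) v * ρ (x - y)) y := by
      intro y
      rw [ContinuousLinearMap.lsmul_apply, inner_smul_right, real_inner_comm]
      by_cases hy : y ∈ K
      · rw [indicator_of_mem hy, indicator_of_mem (hKΩ hy)]; ring
      · have h0 : ρ (x - y) = 0 := hρt y fun h' => hy (hx h')
        by_cases hyΩ : y ∈ Ω
        · rw [indicator_of_mem hyΩ, h0]; simp
        · rw [indicator_of_notMem hyΩ, h0]; simp
    rw [real_inner_comm, ← integral_inner]
    · simp_rw [e1, e2]
      rw [integral_neg]
      have e3 : ∀ k : EuclideanSpace ℝ (Fin n) → ℝ, (∀ y ∉ K, k y = 0) →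
          ∫ y, Ω.indicator k y = ∫ y in Ω, k y := by
        intro k hk
        rw [setIntegral_eq_integral_of_forall_compl_eq_zero (fun y hy => hk y fun h' => hy (hKΩ h'))]
        refine integral_congr_ae (Eventually.of_forall fun y => ?_)
        by_cases hyΩ : y ∈ Ω
        · exact indicator_of_mem hyΩ k
        · exact (indicator_of_notMem hyΩ k).trans (hk y fun h' => hyΩ (hKΩ h')).symm
      rw [e3, e3, hH.integral_eq _ htest v, neg_neg]
      · intro y hy
        rw [hρt y fun h' => hy (hx h'), mul_zero]
      · intro y hy
        rw [hfd, hdρt y fun h' => hy (hx h')]; simp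
    · have := (hρs.convolutionExists_left (ContinuousLinearMap.lsmul ℝ ℝ) hρc.continuous
        hintH.locallyIntegrable) x
      exact this.integrable_swap
  · have := ((hρs.fderiv ℝ).convolutionExists_left (ContinuousLinearMap.precompL
      (EuclideanSpace ℝ (Fin n)) (ContinuousLinearMap.lsmul ℝ ℝ))
      (hρc.continuous_fderiv (by simp)) hint.locallyIntegrable) x
    exact this.integrable_swap

/-- On a compact subset of `Ω`, a continuous function with weak gradient in `L^q_loc(Ω)` is a
limit of smooth functions, uniformly and with gradients converging in `L^q`. -/
theorem IsWeakGradient.exists_contDiff_approx {n : ℕ} {Ω : Set (EuclideanSpace ℝ (Fin n))}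
    (hΩ : IsOpen Ω) {h : EuclideanSpace ℝ (Fin n) → ℝ}
    {H : EuclideanSpace ℝ (Fin n) → EuclideanSpace ℝ (Fin n)} (hH : IsWeakGradient Ω h H)
    (hh : ContinuousOn h Ω) {q : ℝ} (hq : 1 ≤ q) (hHq : MemLpLoc q Ω H)
    {K : Set (EuclideanSpace ℝ (Fin n))} (hK : IsCompact K) (hKΩ : K ⊆ Ω) {ε : ℝ} (hε : 0 < ε) :
    ∃ g : EuclideanSpace ℝ (Fin n) → ℝ, ContDiff ℝ ∞ g ∧ (∀ x ∈ K, |g x - h x| ≤ ε) ∧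
      eLpNorm (fun x => gradient g x - H x) (ENNReal.ofReal q) (volume.restrict K)
        ≤ ENNReal.ofReal ε := by
  obtain ⟨δ, hδ, hδΩ⟩ := hK.exists_cthickening_subset_open hΩ hKΩ
  set K2 := cthickening δ K with hK2
  have hK2c : IsCompact K2 := hK.cthickening
  have hKK2 : K ⊆ K2 := self_subset_cthickening K
  have hball : ∀ x ∈ K, ∀ r ≤ δ, closedBall x r ⊆ K2 := fun x hx r hr =>
    (closedBall_subset_closedBall hr).trans (closedBall_subset_cthickening hx δ)
  have hq1 : 1 ≤ ENNReal.ofReal q := by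
    rw [← ENNReal.ofReal_one]; exact ENNReal.ofReal_le_ofReal hq
  have hH2 : MemLp (K2.indicator H) (ENNReal.ofReal q) volume :=
    (memLp_indicator_iff_restrict hK2c.measurableSet).2 (hHq K2 hK2c hδΩ)
  obtain ⟨δ₁, hδ₁, hconv⟩ := exists_eLpNorm_normed_convolution_sub_le hq1 ENNReal.ofReal_ne_top
    hH2 hK (ε := ENNReal.ofReal ε) (by simpa using hε)
  obtain ⟨δ₂, hδ₂, hunif⟩ := Metric.uniformContinuousOn_iff.1
    (hK2c.uniformContinuousOn_of_continuous (hh.mono hδΩ)) ε hε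
  set r := min δ (min δ₁ δ₂) with hr
  have hr0 : 0 < r := by positivity
  let φ : ContDiffBump (0 : EuclideanSpace ℝ (Fin n)) := ⟨r / 2, r, by positivity, by linarith⟩
  have hφ : φ.rOut = r := rfl
  have hint : Integrable (K2.indicator h) volume :=
    hH.locInt.integrable_indicator hK2c hδΩ
  refine ⟨φ.normed volume ⋆[ContinuousLinearMap.lsmul ℝ ℝ, volume] K2.indicator h, ?_, ?_, ?_⟩
  · exact φ.hasCompactSupport_normed.contDiff_convolution_left _ φ.contDiff_normed
      hint.locallyIntegrable
  · intro x hx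
    rw [← Real.dist_eq, ← indicator_of_mem (hKK2 hx) h]
    refine ContDiffBump.dist_normed_convolution_le hint.1 fun y hy => ?_
    have hy2 : y ∈ K2 := hball x hx r (min_le_left _ _) (ball_subset_closedBall hy)
    rw [indicator_of_mem hy2, indicator_of_mem (hKK2 hx)]
    refine (hunif y hy2 x (hKK2 hx) (lt_of_lt_of_le (mem_ball.1 hy) ?_)).le
    exact (min_le_right _ _).trans (min_le_right _ _)
  · refine le_trans (le_of_eq (eLpNorm_congr_ae ?_))
      (hconv φ ((min_le_right _ _).trans (min_le_left _ _)))
    filter_upwards [ae_restrict_mem hK.measurableSet] with x hx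
    rw [hH.gradient_normed_convolution hK2c hδΩ φ (hball x hx r (min_le_left _ _)), Pi.sub_apply,
      indicator_of_mem (hKK2 hx) H]

/-! ### The comparison principle -/

/-- Hölder's inequality for the inner product. -/
theorem eLpNorm_inner_le {α E : Type*} [MeasurableSpace α] {μ : Measure α}
    [NormedAddCommGroup E] [InnerProductSpace ℝ E] {p q : ℝ≥0∞} [p.HolderConjugate q]
    {f g : α → E} (hf : AEStronglyMeasurable f μ) (hg : AEStronglyMeasurable g μ) :
    eLpNorm (fun x => inner ℝ (f x) (g x)) 1 μ ≤ eLpNorm f p μ * eLpNorm g q μ := by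
  have := eLpNorm_le_eLpNorm_mul_eLpNorm_of_nnnorm (p := p) (q := q) (r := 1) hf hg
    (fun a b => inner ℝ a b) 1 (Eventually.of_forall fun x => by
      rw [one_mul]; exact nnnorm_inner_le_nnnorm _ _)
  simpa using this

theorem MeasureTheory.MemLp.integrable_inner_of_holderConjugate {α E : Type*} [MeasurableSpace α]
    {μ : Measure α} [NormedAddCommGroup E] [InnerProductSpace ℝ E] {p q : ℝ≥0∞}
    [p.HolderConjugate q] {f g : α → E} (hf : MemLp f p μ) (hg : MemLp g q μ) :
    Integrable (fun x => inner ℝ (f x) (g x)) μ :=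
  memLp_one_iff_integrable.1 ⟨hf.1.inner hg.1,
    (eLpNorm_inner_le hf.1 hg.1).trans_lt (ENNReal.mul_lt_top hf.2 hg.2)⟩

/-- Passage to the limit in `∫ c_k ⟨F, D_k⟩` when the weights `c_k` are bounded and converge
pointwise and `D_k → H` in the space dual to that of `F`. -/
theorem tendsto_integral_mul_inner {α E : Type*} [MeasurableSpace α] {μ : Measure α}
    [NormedAddCommGroup E] [InnerProductSpace ℝ E] {p q : ℝ≥0∞} [p.HolderConjugate q]
    {F H : α → E} {D : ℕ → α → E} {c : ℕ → α → ℝ} {c₀ : α → ℝ} {C : ℝ}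
    (hF : MemLp F p μ) (hH : MemLp H q μ) (hD : ∀ k, AEStronglyMeasurable (D k) μ)
    (hDH : Tendsto (fun k => eLpNorm (fun x => D k x - H x) q μ) atTop (𝓝 0))
    (hc : ∀ k, AEStronglyMeasurable (c k) μ) (hcC : ∀ k, ∀ᵐ x ∂μ, |c k x| ≤ C)
    (hlim : ∀ᵐ x ∂μ, Tendsto (fun k => c k x) atTop (𝓝 (c₀ x))) :
    Tendsto (fun k => ∫ x, c k x * inner ℝ (F x) (D k x) ∂μ) atTop
      (𝓝 (∫ x, c₀ x * inner ℝ (F x) (H x) ∂μ)) := by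
  have hFH : Integrable (fun x => inner ℝ (F x) (H x)) μ :=
    hF.integrable_inner_of_holderConjugate hH
  have h1 : Tendsto (fun k => ∫ x, c k x * inner ℝ (F x) (H x) ∂μ) atTop
      (𝓝 (∫ x, c₀ x * inner ℝ (F x) (H x) ∂μ)) := by
    refine tendsto_integral_of_dominated_convergence
      (fun x => C * ‖inner ℝ (F x) (H x)‖) (fun k => (hc k).mul hFH.1)
      (hFH.norm.const_mul C) (fun k => ?_) ?_
    · filter_upwards [hcC k] with x hx
      rw [norm_mul, Real.norm_eq_abs]
      gcongr
    · filter_upwards [hlim] with x hx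
      exact hx.mul_const _
  have h2 : Tendsto (fun k => ∫ x, c k x * inner ℝ (F x) (D k x - H x) ∂μ) atTop (𝓝 0) := by
    rw [tendsto_zero_iff_enorm_tendsto_zero]
    have hb : ∀ k, ‖∫ x, c k x * inner ℝ (F x) (D k x - H x) ∂μ‖ₑ
        ≤ ENNReal.ofReal C * (eLpNorm F p μ * eLpNorm (fun x => D k x - H x) q μ) := by
      intro k
      refine (enorm_integral_le_lintegral_enorm _).trans ?_
      refine le_trans ?_ (mul_le_mul_right (eLpNorm_inner_le (p := p) (q := q) hF.1
        ((hD k).sub hH.1)) (ENNReal.ofReal C))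
      rw [eLpNorm_one_eq_lintegral_enorm, ← lintegral_const_mul' _ _ ENNReal.ofReal_ne_top]
      refine lintegral_mono_ae ?_
      filter_upwards [hcC k] with x hx
      rw [enorm_mul]
      refine mul_le_mul' ?_ le_rfl
      rw [← ofReal_norm, Real.norm_eq_abs]
      exact ENNReal.ofReal_le_ofReal hx
    refine tendsto_of_tendsto_of_tendsto_of_le_of_le tendsto_const_nhds ?_
      (fun _ => zero_le) hb
    have := ENNReal.Tendsto.const_mul (a := ENNReal.ofReal C)
      (ENNReal.Tendsto.const_mul (a := eLpNorm F p μ) hDH (Or.inr hF.2.ne))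
      (Or.inr ENNReal.ofReal_ne_top)
    simpa using this
  have hev : ∀ᶠ k in atTop, eLpNorm (fun x => D k x - H x) q μ < ⊤ :=
    hDH.eventually (gt_mem_nhds ENNReal.zero_lt_top)
  have h3 := h1.add h2
  rw [add_zero] at h3
  refine h3.congr' ?_
  filter_upwards [hev] with k hk
  have hDk : Integrable (fun x => inner ℝ (F x) (D k x - H x)) μ :=
    hF.integrable_inner_of_holderConjugate (q := q) ⟨(hD k).sub hH.1, hk⟩
  rw [← integral_add (hFH.bdd_mul (hc k) (hcC k)) (hDk.bdd_mul (hc k) (hcC k))]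
  refine integral_congr_ae (Eventually.of_forall fun x => ?_)
  simp only [inner_sub_right]
  ring

/-- If `g ≤ 0` near the boundary of the compact set `K₁`, cutting `ψ ∘ g` off to zero outside `K₁`
gives a test function with the expected gradient, where `ψ = expNegInvGlue` vanishes on
`(-∞, 0]`. -/
theorem isTestFunction_indicator_expNegInvGlue {n : ℕ} {Ω K₁ K₂ : Set (EuclideanSpace ℝ (Fin n))}
    (hK₁ : IsCompact K₁) (hK₁₂ : K₁ ⊆ interior K₂) (hK₁Ω : K₁ ⊆ Ω)
    {C : Set (EuclideanSpace ℝ (Fin n))} (hC : C ⊆ K₁)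
    {g : EuclideanSpace ℝ (Fin n) → ℝ} (hg : ContDiff ℝ ∞ g)
    (hneg : ∀ x ∈ K₂ \ C, g x ≤ 0) :
    IsTestFunction Ω (K₁.indicator fun x => expNegInvGlue (g x)) ∧
      ∀ x, gradient (K₁.indicator fun x => expNegInvGlue (g x)) x
        = K₁.indicator (fun x => deriv expNegInvGlue (g x) • gradient g x) x := by
  have hψ : ContDiff ℝ ∞ expNegInvGlue := expNegInvGlue.contDiff
  have hcomp : ContDiff ℝ ∞ (fun x => expNegInvGlue (g x)) := hψ.comp hg
  set φ := K₁.indicator fun x => expNegInvGlue (g x) with hφ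
  have hin : ∀ x ∈ interior K₂, φ =ᶠ[𝓝 x] fun x => expNegInvGlue (g x) := by
    intro x hx
    filter_upwards [isOpen_interior.mem_nhds hx] with y hy
    by_cases hy1 : y ∈ K₁
    · exact indicator_of_mem hy1 _
    · rw [hφ, indicator_of_notMem hy1, expNegInvGlue.zero_of_nonpos
        (hneg y ⟨interior_subset hy, fun h => hy1 (hC h)⟩)]
  have hout : ∀ x ∉ K₁, φ =ᶠ[𝓝 x] fun _ => 0 := by
    intro x hx
    filter_upwards [hK₁.isClosed.isOpen_compl.mem_nhds hx] with y hy
    exact indicator_of_notMem hy _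
  have hsub : Function.support φ ⊆ K₁ := fun x hx => by
    by_contra h
    exact hx (indicator_of_notMem h _)
  refine ⟨⟨?_, HasCompactSupport.of_support_subset_isCompact hK₁ hsub,
    (closure_minimal hsub hK₁.isClosed).trans hK₁Ω⟩, fun x => ?_⟩
  · refine contDiff_iff_contDiffAt.2 fun x => ?_
    by_cases hx : x ∈ K₁
    · exact hcomp.contDiffAt.congr_of_eventuallyEq (hin x (hK₁₂ hx))
    · exact contDiffAt_const.congr_of_eventuallyEq (hout x hx)
  · by_cases hx : x ∈ K₁
    · rw [(hin x (hK₁₂ hx)).gradient_eq, indicator_of_mem hx]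
      refine ext_inner_right ℝ fun v => ?_
      have h1 : HasDerivAt expNegInvGlue (deriv expNegInvGlue (g x)) (g x) :=
        (hψ.differentiable (by simp)).differentiableAt.hasDerivAt
      have h2 : HasFDerivAt g (fderiv ℝ g x) x :=
        (hg.differentiable (by simp)).differentiableAt.hasFDerivAt
      have h3 : fderiv ℝ (fun x => expNegInvGlue (g x)) x = _ := (h1.comp_hasFDerivAt x h2).fderiv
      rw [inner_gradient_left, h3, inner_smul_left, inner_gradient_left]
      simp
    · rw [(hout x hx).gradient_eq, indicator_of_notMem hx, gradient_fun_const]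

/-- Comparison principle in weak form. A continuous Sobolev function `h` which is negative outside
a compact subset of `Ω` is nonpositive, provided that some divergence-free field `F` in the dual
space satisfies `⟨F, ∇h⟩ ≥ 0`, with equality only where `∇h = 0`. -/
theorem IsWeakGradient.nonpos_of_divergence_free {n : ℕ} (hn : 0 < n)
    {Ω : Set (EuclideanSpace ℝ (Fin n))} (hΩ : IsOpen Ω)
    {p q : ℝ} (hpq : q.HolderConjugate p) {h : EuclideanSpace ℝ (Fin n) → ℝ}
    {F H : EuclideanSpace ℝ (Fin n) → EuclideanSpace ℝ (Fin n)}
    (hh : ContinuousOn h Ω) (hH : IsWeakGradient Ω h H) (hHp : MemLpLoc p Ω H)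
    (hFq : MemLpLoc q Ω F)
    (hdiv : ∀ φ : EuclideanSpace ℝ (Fin n) → ℝ, IsTestFunction Ω φ →
      ∫ x in Ω, inner ℝ (F x) (gradient φ x) = 0)
    (hmono : ∀ x ∈ Ω, 0 ≤ inner ℝ (F x) (H x))
    (hstrict : ∀ x ∈ Ω, inner ℝ (F x) (H x) = 0 → H x = 0)
    (hK : IsCompact {x ∈ Ω | 0 ≤ h x}) : ∀ x ∈ Ω, h x ≤ 0 := by
  set K := {x ∈ Ω | 0 ≤ h x} with hKdef
  have hKΩ : K ⊆ Ω := fun x hx => hx.1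
  obtain ⟨K₂, hK₂, hKK₂, hK₂Ω⟩ := exists_compact_between hK hΩ hKΩ
  obtain ⟨K₁, hK₁, hKK₁, hK₁₂⟩ := exists_compact_between hK isOpen_interior hKK₂
  have hK₁K₂ : K₁ ⊆ K₂ := hK₁₂.trans interior_subset
  have hK₁Ω : K₁ ⊆ Ω := hK₁K₂.trans hK₂Ω
  have hKsub : K ⊆ K₁ := hKK₁.trans interior_subset
  have : (ENNReal.ofReal q).HolderConjugate (ENNReal.ofReal p) := hpq.ennrealOfReal
  have : IsFiniteMeasure (volume.restrict K₁) :=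
    ⟨by rw [Measure.restrict_apply_univ]; exact hK₁.measure_lt_top⟩
  -- `h` is bounded away from zero on the shell between `K₁` and `K₂`
  obtain ⟨m, hm, hmle⟩ : ∃ m > 0, ∀ x ∈ K₂ \ interior K₁, h x ≤ -m := by
    have hc : IsCompact (K₂ \ interior K₁) := hK₂.diff isOpen_interior
    rcases (K₂ \ interior K₁).eq_empty_or_nonempty with he | hne
    · exact ⟨1, one_pos, by simp [he]⟩
    · obtain ⟨y, hy, hmax⟩ := hc.exists_isMaxOn hne (hh.mono (sdiff_subset.trans hK₂Ω))
      refine ⟨-h y, ?_, fun x hx => by simpa using hmax hx⟩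
      by_contra h0
      exact hy.2 (hKK₁ ⟨hK₂Ω hy.1, by linarith⟩)
  set e : ℕ → ℝ := fun k => m / (k + 1) with he
  have he0 : ∀ k, 0 < e k := fun k => by positivity
  have hem : ∀ k, e k ≤ m := fun k => by
    rw [he]; exact div_le_self hm.le (by linarith [(Nat.cast_nonneg k : (0:ℝ) ≤ k)])
  have helim : Tendsto e atTop (𝓝 0) := by
    have := (tendsto_one_div_add_atTop_nhds_zero_nat (𝕜 := ℝ)).const_mul m
    simpa [he, div_eq_mul_inv] using this
  choose g hgs hgu hgD using fun k =>
    hH.exists_contDiff_approx hΩ hh hpq.symm.lt.le hHp hK₂ hK₂Ω (he0 k)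
  have hneg : ∀ k, ∀ x ∈ K₂ \ interior K₁, g k x ≤ 0 := fun k x hx => by
    have h1 := (abs_le.1 (hgu k x hx.1)).2
    linarith [hem k, hmle x hx]
  have htest := fun k => isTestFunction_indicator_expNegInvGlue hK₁ hK₁₂ hK₁Ω interior_subset (hgs k) (hneg k)
  have hglim : ∀ x ∈ K₁, Tendsto (fun k => g k x) atTop (𝓝 (h x)) := by
    intro x hx
    rw [tendsto_iff_dist_tendsto_zero]
    exact squeeze_zero (fun _ => dist_nonneg)
      (fun k => by rw [Real.dist_eq]; exact hgu k x (hK₁K₂ hx)) helim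
  -- uniform bound for the approximations
  obtain ⟨M, hM⟩ : ∃ M, ∀ k, ∀ x ∈ K₁, g k x ∈ Icc (-M) M := by
    obtain ⟨M, hM⟩ := hK₁.exists_bound_of_continuousOn (hh.mono hK₁Ω)
    refine ⟨M + m, fun k x hx => ?_⟩
    have h1 := abs_le.1 (hgu k x (hK₁K₂ hx))
    have h2 := abs_le.1 (hM x hx)
    exact ⟨by linarith [hem k], by linarith [hem k]⟩
  have hψ : ContDiff ℝ ∞ expNegInvGlue := expNegInvGlue.contDiff
  have hψ' : Continuous (deriv expNegInvGlue) := hψ.continuous_deriv (by simp)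
  obtain ⟨C, hC⟩ := (isCompact_Icc (a := -M) (b := M)).exists_bound_of_continuousOn
    hψ'.continuousOn
  obtain ⟨C', hC'⟩ := (isCompact_Icc (a := -M) (b := M)).exists_bound_of_continuousOn
    hψ.continuous.continuousOn
  have hgradc : ∀ k, Continuous (gradient (g k)) := fun k =>
    (InnerProductSpace.toDual ℝ _).symm.continuous.comp
      ((hgs k).continuous_fderiv (by simp))
  have hDH : Tendsto (fun k => eLpNorm (fun x => gradient (g k) x - H x) (ENNReal.ofReal p)
      (volume.restrict K₁)) atTop (𝓝 0) := by
    refine tendsto_of_tendsto_of_tendsto_of_le_of_le tendsto_const_nhds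
      (h := fun k => ENNReal.ofReal (e k)) ?_ (fun _ => zero_le) fun k =>
        (eLpNorm_mono_measure _ (Measure.restrict_mono hK₁K₂ le_rfl)).trans (hgD k)
    simpa using ENNReal.tendsto_ofReal helim
  have key : ∀ A : EuclideanSpace ℝ (Fin n) → EuclideanSpace ℝ (Fin n),
      MemLp A (ENNReal.ofReal q) (volume.restrict K₁) →
      Tendsto (fun k => ∫ x in K₁, deriv expNegInvGlue (g k x) *
        inner ℝ (A x) (gradient (g k) x)) atTop
        (𝓝 (∫ x in K₁, deriv expNegInvGlue (h x) * inner ℝ (A x) (H x))) := by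
    intro A hA
    refine tendsto_integral_mul_inner (C := C) hA (hHp K₁ hK₁ hK₁Ω)
      (fun k => (hgradc k).aestronglyMeasurable) hDH
      (fun k => (hψ'.comp (hgs k).continuous).aestronglyMeasurable) (fun k => ?_) ?_
    · filter_upwards [ae_restrict_mem hK₁.measurableSet] with x hx
      exact hC _ (hM k x hx)
    · filter_upwards [ae_restrict_mem hK₁.measurableSet] with x hx
      exact (hψ'.tendsto _).comp (hglim x hx)
  have hFH : Integrable (fun x => deriv expNegInvGlue (h x) * inner ℝ (F x) (H x))
      (volume.restrict K₁) := by
    refine ((hFq K₁ hK₁ hK₁Ω).integrable_inner_of_holderConjugate (hHp K₁ hK₁ hK₁Ω)).bdd_mul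
      (c := C) ?_ ?_
    · exact (hψ'.comp_continuousOn (hh.mono hK₁Ω)).aestronglyMeasurable hK₁.measurableSet
    · filter_upwards [ae_restrict_mem hK₁.measurableSet] with x hx
      exact le_of_tendsto ((hψ'.tendsto _).comp (hglim x hx)).norm
        (Eventually.of_forall fun k => hC _ (hM k x hx))
  -- the weak equation forces `ψ'(h) ∇h = 0`
  have hzero : ∀ᵐ x ∂volume.restrict K₁, deriv expNegInvGlue (h x) • H x = 0 := by
    have h0 : ∫ x in K₁, deriv expNegInvGlue (h x) * inner ℝ (F x) (H x) = 0 := by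
      refine tendsto_nhds_unique (key F (hFq K₁ hK₁ hK₁Ω)) ?_
      refine tendsto_const_nhds.congr fun k => ?_
      rw [← hdiv _ (htest k).1]
      have hset : ∀ f : EuclideanSpace ℝ (Fin n) → ℝ,
          ∫ x in K₁, f x = ∫ x in Ω, K₁.indicator f x := fun f => by
        rw [setIntegral_indicator hK₁.measurableSet, inter_eq_self_of_subset_right hK₁Ω]
      rw [hset]
      refine integral_congr_ae (Eventually.of_forall fun x => ?_)
      simp only
      rw [(htest k).2]
      by_cases hx : x ∈ K₁
      · rw [indicator_of_mem hx, indicator_of_mem hx, inner_smul_right]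
      · rw [indicator_of_notMem hx, indicator_of_notMem hx, inner_zero_right]
    have hnn : 0 ≤ᵐ[volume.restrict K₁]
        fun x => deriv expNegInvGlue (h x) * inner ℝ (F x) (H x) := by
      filter_upwards [ae_restrict_mem hK₁.measurableSet] with x hx
      exact mul_nonneg expNegInvGlue.monotone.deriv_nonneg (hmono x (hK₁Ω hx))
    have h1 := (integral_eq_zero_iff_of_nonneg_ae hnn hFH).1 h0
    filter_upwards [h1, ae_restrict_mem hK₁.measurableSet] with x hx hxK
    rcases mul_eq_zero.1 hx with h2 | h2
    · rw [h2, zero_smul]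
    · rw [hstrict x (hK₁Ω hxK) h2, smul_zero]
  -- integration by parts against a coordinate function shows that `∫ ψ(h) = 0`
  set i : Fin n := ⟨0, hn⟩
  set v : EuclideanSpace ℝ (Fin n) := EuclideanSpace.single i 1 with hv
  set ℓ : EuclideanSpace ℝ (Fin n) →L[ℝ] ℝ := innerSL ℝ v with hℓ
  have hℓv : ℓ v = 1 := by
    rw [hℓ, innerSL_apply_apply, real_inner_self_eq_norm_sq, hv]; simp
  have hAc : Continuous fun x : EuclideanSpace ℝ (Fin n) => ℓ x • v :=
    ℓ.continuous.smul continuous_const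
  have hA : MemLp (fun x => ℓ x • v) (ENNReal.ofReal q) (volume.restrict K₁) := by
    obtain ⟨B, hB⟩ := hK₁.exists_bound_of_continuousOn hAc.continuousOn
    refine MemLp.of_bound hAc.aestronglyMeasurable B ?_
    filter_upwards [ae_restrict_mem hK₁.measurableSet] with x hx using hB x hx
  have hparts : ∀ k, ∫ x in K₁, expNegInvGlue (g k x)
      = - ∫ x in K₁, deriv expNegInvGlue (g k x) * inner ℝ (ℓ x • v) (gradient (g k) x) := by
    intro k
    obtain ⟨⟨hs, hcs, -⟩, hgr⟩ := htest k
    set φ := K₁.indicator fun x => expNegInvGlue (g k x) with hφ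
    have hφc : Continuous φ := hs.continuous
    have hφ' : Continuous fun x => fderiv ℝ φ x v :=
      (hs.continuous_fderiv (by simp)).clm_apply continuous_const
    have hcs' : HasCompactSupport fun x => fderiv ℝ φ x v := hcs.fderiv_apply ℝ v
    have h := integral_mul_fderiv_eq_neg_fderiv_mul_of_integrable (μ := volume)
      (f := fun x => ℓ x) (g := φ) (v := v)
      ((((ℓ.contDiff (n := 1)).continuous_fderiv (by simp)).clm_apply continuous_const).mul
        hφc |>.integrable_of_hasCompactSupport hcs.mul_left)
      ((ℓ.continuous.mul hφ').integrable_of_hasCompactSupport hcs'.mul_left)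
      ((ℓ.continuous.mul hφc).integrable_of_hasCompactSupport hcs.mul_left)
      (fun x _ => ℓ.differentiableAt) (fun x _ => (hs.differentiable (by simp)).differentiableAt)
    simp only [ContinuousLinearMap.fderiv, hℓv, one_mul] at h
    rw [eq_neg_iff_add_eq_zero, add_comm, ← eq_neg_iff_add_eq_zero]
    rw [hφ, integral_indicator hK₁.measurableSet, ← hφ] at h
    rw [← h, ← integral_indicator hK₁.measurableSet]
    refine integral_congr_ae (Eventually.of_forall fun x => ?_)
    simp only
    rw [← inner_gradient_left, hgr]
    by_cases hx : x ∈ K₁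
    · rw [indicator_of_mem hx, indicator_of_mem hx, inner_smul_left, inner_smul_left,
        real_inner_comm v]
      simp only [RCLike.conj_to_real]
      ring
    · rw [indicator_of_notMem hx, indicator_of_notMem hx, inner_zero_left, mul_zero]
  have hψint : ∫ x in K₁, expNegInvGlue (h x) = 0 := by
    have h1 : Tendsto (fun k => ∫ x in K₁, expNegInvGlue (g k x)) atTop
        (𝓝 (∫ x in K₁, expNegInvGlue (h x))) := by
      refine tendsto_integral_of_dominated_convergence (fun _ => C')
        (fun k => (hψ.continuous.comp (hgs k).continuous).aestronglyMeasurable)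
        (integrable_const _) (fun k => ?_) ?_
      · filter_upwards [ae_restrict_mem hK₁.measurableSet] with x hx
        exact hC' _ (hM k x hx)
      · filter_upwards [ae_restrict_mem hK₁.measurableSet] with x hx
        exact (hψ.continuous.tendsto _).comp (hglim x hx)
    have h2 := (key _ hA).neg
    rw [← funext hparts] at h2
    rw [tendsto_nhds_unique h1 h2, neg_eq_zero]
    refine integral_eq_zero_of_ae ?_
    filter_upwards [hzero] with x hx
    rw [← inner_smul_right, hx, inner_zero_right]
    rfl
  have hψint' : Integrable (fun x => expNegInvGlue (h x)) (volume.restrict K₁) :=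
    (hψ.continuous.comp_continuousOn (hh.mono hK₁Ω)).integrableOn_compact hK₁
  have hae := (integral_eq_zero_iff_of_nonneg_ae
    (Eventually.of_forall fun x => expNegInvGlue.nonneg (h x)) hψint').1 hψint
  -- the open set `{h > 0}` is a null set, hence empty
  intro x hx
  by_contra hpos
  push Not at hpos
  have hU : IsOpen (Ω ∩ h ⁻¹' Ioi 0) := hh.isOpen_inter_preimage hΩ isOpen_Ioi
  have hU0 := hU.measure_pos volume ⟨x, hx, hpos⟩
  refine hU0.ne' ?_
  rw [Filter.EventuallyEq, ae_restrict_iff' hK₁.measurableSet] at hae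
  refine measure_mono_null (fun y hy => ?_) (ae_iff.1 hae)
  simp only [mem_ofPred_eq, Classical.not_imp]
  exact ⟨hKsub ⟨hy.1, (mem_Ioi.1 hy.2).le⟩, (expNegInvGlue.pos_of_pos hy.2).ne'⟩

/-! ### Comparison of `p`-harmonic functions -/

/-- The quantitative monotonicity of the vector field `a ↦ |a|^r a`. -/
theorem inner_rpow_smul_sub_ge {E : Type*} [NormedAddCommGroup E] [InnerProductSpace ℝ E]
    {r : ℝ} (hr : 0 ≤ r) (a b : E) :
    (‖a‖ ^ r + ‖b‖ ^ r) / 2 * ‖a - b‖ ^ 2 ≤ inner ℝ (‖a‖ ^ r • a - ‖b‖ ^ r • b) (a - b) := by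
  have h1 : inner ℝ (‖a‖ ^ r • a - ‖b‖ ^ r • b) (a - b)
      = (‖a‖ ^ r + ‖b‖ ^ r) / 2 * ‖a - b‖ ^ 2
        + (‖a‖ ^ r - ‖b‖ ^ r) / 2 * (‖a‖ ^ 2 - ‖b‖ ^ 2) := by
    rw [norm_sub_sq_real]
    simp only [inner_sub_left, inner_sub_right, real_inner_smul_left, real_inner_self_eq_norm_sq,
      real_inner_comm a b]
    ring
  have h2 : 0 ≤ (‖a‖ ^ r - ‖b‖ ^ r) / 2 * (‖a‖ ^ 2 - ‖b‖ ^ 2) := by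
    rcases le_total ‖a‖ ‖b‖ with h | h
    · refine mul_nonneg_of_nonpos_of_nonpos ?_ ?_
      · linarith [Real.rpow_le_rpow (norm_nonneg a) h hr]
      · linarith [pow_le_pow_left₀ (norm_nonneg a) h 2]
    · refine mul_nonneg ?_ ?_
      · linarith [Real.rpow_le_rpow (norm_nonneg b) h hr]
      · linarith [pow_le_pow_left₀ (norm_nonneg b) h 2]
  rw [h1]
  linarith

theorem inner_rpow_smul_sub_nonneg {E : Type*} [NormedAddCommGroup E] [InnerProductSpace ℝ E]
    {r : ℝ} (hr : 0 ≤ r) (a b : E) :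
    0 ≤ inner ℝ (‖a‖ ^ r • a - ‖b‖ ^ r • b) (a - b) :=
  le_trans (by positivity) (inner_rpow_smul_sub_ge hr a b)

theorem eq_of_inner_rpow_smul_sub_eq_zero {E : Type*} [NormedAddCommGroup E]
    [InnerProductSpace ℝ E] {r : ℝ} (hr : 0 ≤ r) {a b : E}
    (h : inner ℝ (‖a‖ ^ r • a - ‖b‖ ^ r • b) (a - b) = 0) : a = b := by
  by_contra hab
  have h1 := inner_rpow_smul_sub_ge hr a b
  have h2 : 0 < ‖a - b‖ ^ 2 := by
    have := norm_pos_iff.2 (sub_ne_zero.2 hab)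
    positivity
  have h3 : 0 < ‖a‖ ^ r + ‖b‖ ^ r := by
    by_cases ha : a = 0
    · have hb : 0 < ‖b‖ := norm_pos_iff.2 fun hb => hab (ha.trans hb.symm)
      have := Real.rpow_pos_of_pos hb r
      positivity
    · have := Real.rpow_pos_of_pos (norm_pos_iff.2 ha) r
      positivity
  rw [h] at h1
  have : 0 < (‖a‖ ^ r + ‖b‖ ^ r) / 2 * ‖a - b‖ ^ 2 := by positivity
  linarith

/-- If `G ∈ L^p_loc`, then `|G|^{p-2} G` lies in `L^{p/(p-1)}_loc`. -/
theorem MemLpLoc.rpow_smul {n : ℕ} {E : Type*} [NormedAddCommGroup E] [NormedSpace ℝ E] {p : ℝ}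
    (hp : 2 < p)
    {Ω : Set (EuclideanSpace ℝ (Fin n))} {G : EuclideanSpace ℝ (Fin n) → E}
    (hG : MemLpLoc p Ω G) : MemLpLoc (p / (p - 1)) Ω (fun x => ‖G x‖ ^ (p - 2) • G x) := by
  intro K hK hKΩ
  have h := hG K hK hKΩ
  have h1 := h.norm_rpow_div (ENNReal.ofReal (p - 1))
  rw [← ENNReal.ofReal_div_of_pos (by linarith), ENNReal.toReal_ofReal (by linarith)] at h1
  refine h1.mono ((((h.1.norm.aemeasurable.pow_const (p - 2)).aestronglyMeasurable).smul h.1))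
    (Eventually.of_forall fun x => le_of_eq ?_)
  rw [norm_smul, Real.norm_eq_abs, Real.norm_eq_abs, abs_of_nonneg (by positivity),
    abs_of_nonneg (by positivity)]
  rcases eq_or_ne ‖G x‖ 0 with h0 | h0
  · rw [h0, mul_zero, Real.zero_rpow (by linarith)]
  · have hpos : 0 < ‖G x‖ := lt_of_le_of_ne (norm_nonneg _) (Ne.symm h0)
    rw [show p - 1 = (p - 2) + 1 by ring, Real.rpow_add hpos, Real.rpow_one]

theorem MemLpLoc.sub {n : ℕ} {E : Type*} [NormedAddCommGroup E] {p : ℝ}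
    {Ω : Set (EuclideanSpace ℝ (Fin n))} {f g : EuclideanSpace ℝ (Fin n) → E}
    (hf : MemLpLoc p Ω f) (hg : MemLpLoc p Ω g) : MemLpLoc p Ω (f - g) :=
  fun K hK hKΩ => (hf K hK hKΩ).sub (hg K hK hKΩ)

theorem MemLpLoc.mono_exponent {n : ℕ} {E : Type*} [NormedAddCommGroup E] {p q : ℝ} (hqp : q ≤ p)
    {Ω : Set (EuclideanSpace ℝ (Fin n))} {f : EuclideanSpace ℝ (Fin n) → E}
    (hf : MemLpLoc p Ω f) : MemLpLoc q Ω f := fun K hK hKΩ => by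
  have : IsFiniteMeasure (volume.restrict K) :=
    ⟨by rw [Measure.restrict_apply_univ]; exact hK.measure_lt_top⟩
  exact (hf K hK hKΩ).mono_exponent (ENNReal.ofReal_le_ofReal hqp)

theorem ContinuousOn.memLpLoc {n : ℕ} {E : Type*} [NormedAddCommGroup E]
    {Ω : Set (EuclideanSpace ℝ (Fin n))} {f : EuclideanSpace ℝ (Fin n) → E}
    (hf : ContinuousOn f Ω) (p : ℝ) : MemLpLoc p Ω f := fun K hK hKΩ => by
  have : IsFiniteMeasure (volume.restrict K) :=
    ⟨by rw [Measure.restrict_apply_univ]; exact hK.measure_lt_top⟩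
  obtain ⟨C, hC⟩ := hK.exists_bound_of_continuousOn (hf.mono hKΩ)
  refine MemLp.of_bound ((hf.mono hKΩ).aestronglyMeasurable_of_isCompact hK hK.measurableSet) C ?_
  filter_upwards [ae_restrict_mem hK.measurableSet] with x hx using hC x hx

theorem MemLpLoc.integrable_inner {n : ℕ} {E : Type*} [NormedAddCommGroup E]
    [InnerProductSpace ℝ E] {Ω K : Set (EuclideanSpace ℝ (Fin n))}
    {f ψ : EuclideanSpace ℝ (Fin n) → E} (hf : MemLpLoc 1 Ω f) (hψ : Continuous ψ)
    (hK : IsCompact K) (hKΩ : K ⊆ Ω) (h0 : ∀ x ∉ K, ψ x = 0) :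
    Integrable (fun x => inner ℝ (f x) (ψ x)) (volume.restrict Ω) := by
  refine Integrable.mono_measure (ν := volume) ?_ Measure.restrict_le_self
  have hsub : Function.support (fun x => inner ℝ (f x) (ψ x)) ⊆ K := fun x hx => by
    by_contra h
    exact hx (by simp only [h0 x h, inner_zero_right])
  rw [← integrableOn_iff_integrable_of_support_subset hsub]
  have h1 := hf K hK hKΩ
  rw [ENNReal.ofReal_one] at h1
  obtain ⟨C, hC⟩ := hK.exists_bound_of_continuousOn hψ.continuousOn
  have : ENNReal.HolderConjugate 1 ⊤ := ENNReal.HolderConjugate.one_top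
  refine h1.integrable_inner_of_holderConjugate (q := ⊤) ?_
  refine memLp_top_of_bound hψ.aestronglyMeasurable C ?_
  filter_upwards [ae_restrict_mem hK.measurableSet] with x hx using hC x hx

theorem IsTestFunction.continuous_gradient {n : ℕ} {Ω : Set (EuclideanSpace ℝ (Fin n))}
    {φ : EuclideanSpace ℝ (Fin n) → ℝ} (hφ : IsTestFunction Ω φ) : Continuous (gradient φ) :=
  (InnerProductSpace.toDual ℝ _).symm.continuous.comp (hφ.smooth.continuous_fderiv (by simp))

theorem fderiv_eq_zero_of_notMem_tsupport {E : Type*} [NormedAddCommGroup E] [NormedSpace ℝ E]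
    {φ : E → ℝ} {x : E} (hx : x ∉ tsupport φ) : fderiv ℝ φ x = 0 := by
  by_contra h
  exact hx (support_fderiv_subset ℝ h)

theorem gradient_eq_zero_of_notMem_tsupport {n : ℕ} {φ : EuclideanSpace ℝ (Fin n) → ℝ}
    {x : EuclideanSpace ℝ (Fin n)} (hx : x ∉ tsupport φ) : gradient φ x = 0 := by
  rw [gradient, fderiv_eq_zero_of_notMem_tsupport hx, map_zero]

theorem IsWeakGradient.sub {n : ℕ} {Ω : Set (EuclideanSpace ℝ (Fin n))}
    {u w : EuclideanSpace ℝ (Fin n) → ℝ}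
    {G H : EuclideanSpace ℝ (Fin n) → EuclideanSpace ℝ (Fin n)}
    (hu : IsWeakGradient Ω u G) (hw : IsWeakGradient Ω w H) :
    IsWeakGradient Ω (u - w) (G - H) := by
  refine ⟨hu.locInt.sub hw.locInt, hu.locInt_grad.sub hw.locInt_grad, fun φ hφ v => ?_⟩
  have h1 : ∀ f : EuclideanSpace ℝ (Fin n) → ℝ, MemLpLoc 1 Ω f →
      Integrable (fun x => f x * fderiv ℝ φ x v) (volume.restrict Ω) := by
    intro f hf
    have := hf.integrable_inner (ψ := fun x => fderiv ℝ φ x v)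
      ((hφ.smooth.continuous_fderiv (by simp)).clm_apply continuous_const) hφ.compactSupport
      hφ.tsupport_subset (fun x hx => by simp [fderiv_eq_zero_of_notMem_tsupport hx])
    refine this.congr (Eventually.of_forall fun x => ?_)
    simp [mul_comm]
  have h2 : ∀ A : EuclideanSpace ℝ (Fin n) → EuclideanSpace ℝ (Fin n), MemLpLoc 1 Ω A →
      Integrable (fun x => inner ℝ (A x) v * φ x) (volume.restrict Ω) := by
    intro A hA
    have := hA.integrable_inner (ψ := fun x => φ x • v)
      (hφ.smooth.continuous.smul continuous_const) hφ.compactSupport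
      hφ.tsupport_subset (fun x hx => by simp [image_eq_zero_of_notMem_tsupport hx])
    refine this.congr (Eventually.of_forall fun x => ?_)
    simp [inner_smul_right, mul_comm]
  simp only [Pi.sub_apply, sub_mul, inner_sub_left]
  rw [integral_sub (h1 u hu.locInt) (h1 w hw.locInt),
    integral_sub (h2 G hu.locInt_grad) (h2 H hw.locInt_grad), hu.integral_eq φ hφ v,
    hw.integral_eq φ hφ v]
  ring

/-- Comparison principle: if `{w ≤ u}` is a compact subset of `Ω`, then `u ≤ w`. -/
theorem IsPHarmonic.le_of_isCompact {n : ℕ} (hn : 0 < n) {Ω : Set (EuclideanSpace ℝ (Fin n))}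
    (hΩ : IsOpen Ω) {p : ℝ} (hp : 2 < p) {u w : EuclideanSpace ℝ (Fin n) → ℝ}
    (hu : IsPHarmonic p Ω u) (hw : IsPHarmonic p Ω w) (huc : ContinuousOn u Ω)
    (hwc : ContinuousOn w Ω) (hK : IsCompact {x ∈ Ω | w x ≤ u x}) : ∀ x ∈ Ω, u x ≤ w x := by
  obtain ⟨G, hG, -, hGp, hGeq⟩ := hu
  obtain ⟨H, hH, -, hHp, hHeq⟩ := hw
  have hpq : (p / (p - 1)).HolderConjugate p :=
    ((Real.holderConjugate_iff_eq_conjExponent (by linarith)).2 rfl).symm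
  have hq1 : 1 ≤ p / (p - 1) := hpq.lt.le
  have hGF := hGp.rpow_smul hp
  have hHF := hHp.rpow_smul hp
  have hint : ∀ A : EuclideanSpace ℝ (Fin n) → EuclideanSpace ℝ (Fin n),
      MemLpLoc (p / (p - 1)) Ω A → ∀ φ, IsTestFunction Ω φ →
      Integrable (fun x => inner ℝ (A x) (gradient φ x)) (volume.restrict Ω) :=
    fun A hA φ hφ => (hA.mono_exponent hq1).integrable_inner hφ.continuous_gradient
      hφ.compactSupport hφ.tsupport_subset fun x hx => gradient_eq_zero_of_notMem_tsupport hx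
  have := (hG.sub hH).nonpos_of_divergence_free hn hΩ hpq (huc.sub hwc) (hGp.sub hHp)
    (hGF.sub hHF) (fun φ hφ => ?_) (fun x _ => inner_rpow_smul_sub_nonneg (by linarith) _ _)
    (fun x _ h => sub_eq_zero.2 (eq_of_inner_rpow_smul_sub_eq_zero (by linarith) h))
    (by simpa [sub_nonneg] using hK)
  · exact fun x hx => sub_nonpos.1 (this x hx)
  · simp only [Pi.sub_apply, inner_sub_left]
    rw [integral_sub (hint _ hGF φ hφ) (hint _ hHF φ hφ)]
    simp only [real_inner_smul_left]
    rw [hGeq φ hφ, hHeq φ hφ, sub_zero]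

/-! ### Classically differentiable functions -/

/-- Integration by parts against a test function needs only a continuous directional derivative
in `Ω`. -/
theorem integral_mul_fderiv_of_hasLineDerivAt {n : ℕ} {Ω : Set (EuclideanSpace ℝ (Fin n))}
    {f f' : EuclideanSpace ℝ (Fin n) → ℝ} {v : EuclideanSpace ℝ (Fin n)}
    (hf : ContinuousOn f Ω) (hf' : ContinuousOn f' Ω)
    (hd : ∀ x ∈ Ω, HasLineDerivAt ℝ f (f' x) x v)
    {φ : EuclideanSpace ℝ (Fin n) → ℝ} (hφ : IsTestFunction Ω φ) :
    ∫ x in Ω, f x * fderiv ℝ φ x v = - ∫ x in Ω, f' x * φ x := by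
  have hint : ∀ k ψ : EuclideanSpace ℝ (Fin n) → ℝ, ContinuousOn k Ω → Continuous ψ →
      (∀ x ∉ tsupport φ, ψ x = 0) → Integrable (fun x => k x * ψ x) volume := by
    intro k ψ hk hψ h0
    have hsub : Function.support (fun x => k x * ψ x) ⊆ tsupport φ := fun x hx => by
      by_contra h
      exact hx (by simp only [h0 x h, mul_zero])
    rw [← integrableOn_iff_integrable_of_support_subset hsub]
    exact ((hk.mono hφ.tsupport_subset).mul hψ.continuousOn).integrableOn_compact
      hφ.compactSupport
  have hc' : Continuous fun x => fderiv ℝ φ x v :=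
    (hφ.smooth.continuous_fderiv (by simp)).clm_apply continuous_const
  have h0 : ∀ x ∉ tsupport φ, φ x = 0 := fun x hx => image_eq_zero_of_notMem_tsupport hx
  have h0' : ∀ x ∉ tsupport φ, fderiv ℝ φ x v = 0 := fun x hx => by
    rw [fderiv_eq_zero_of_notMem_tsupport hx]; rfl
  have h := integral_bilinear_hasLineDerivAt_right_eq_neg_left_of_integrable (μ := volume)
    (f := f) (f' := f') (g := φ) (g' := fun x => fderiv ℝ φ x v) (v := v)
    (B := ContinuousLinearMap.mul ℝ ℝ) (hint f' φ hf' hφ.smooth.continuous h0)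
    (hint f _ hf hc' h0') (hint f φ hf hφ.smooth.continuous h0)
    (fun x hx => hd x (hφ.tsupport_subset hx))
    (fun x _ => ((hφ.smooth.differentiable (by simp)).differentiableAt.hasFDerivAt).hasLineDerivAt v)
  simp only [ContinuousLinearMap.mul_apply'] at h
  rw [setIntegral_eq_integral_of_forall_compl_eq_zero, h,
    setIntegral_eq_integral_of_forall_compl_eq_zero]
  · intro x hx
    rw [h0 x fun h => hx (hφ.tsupport_subset h), mul_zero]
  · intro x hx
    rw [h0' x fun h => hx (hφ.tsupport_subset h), mul_zero]

theorem IsWeakGradient.of_hasLineDerivAt {n : ℕ} {Ω : Set (EuclideanSpace ℝ (Fin n))}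
    {f : EuclideanSpace ℝ (Fin n) → ℝ} {G : EuclideanSpace ℝ (Fin n) → EuclideanSpace ℝ (Fin n)}
    (hf : ContinuousOn f Ω) (hG : ContinuousOn G Ω)
    (hd : ∀ x ∈ Ω, ∀ v, HasLineDerivAt ℝ f (inner ℝ (G x) v) x v) : IsWeakGradient Ω f G :=
  ⟨hf.memLpLoc 1, hG.memLpLoc 1, fun _ hφ v => integral_mul_fderiv_of_hasLineDerivAt hf
    (hG.inner continuousOn_const) (fun x hx => hd x hx v) hφ⟩

/-! ### The Riccati equation of the singular planar solution -/

/-- The constant `B = b² + (p-2)b/(p-1)` for which the separated function `r^{-b} f(θ)` is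
`p`-harmonic in the plane iff `s = -f'/f` satisfies `s' = riccatiRate p b s`. -/
def riccatiConst (p b : ℝ) : ℝ := b ^ 2 + (p - 2) * b / (p - 1)

/-- The right-hand side of the autonomous equation `s' = riccatiRate p b s` for `s = -f'/f`. -/
def riccatiRate (p b s : ℝ) : ℝ :=
  (p - 1) * (s ^ 2 + b ^ 2) * (s ^ 2 + riccatiConst p b) / (b ^ 2 + (p - 1) * s ^ 2)

/-- The angle at which the odd solution of the Riccati equation takes the value `s`, that is the
primitive of `1 / riccatiRate p b` vanishing at `0`, computed by partial fractions. -/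
def riccatiAngle (p b s : ℝ) : ℝ :=
  -Real.arctan (s / b) + (1 + b) / √(riccatiConst p b) * Real.arctan (s / √(riccatiConst p b))

theorem riccatiConst_pos {p b : ℝ} (hp : 2 < p) (hb : 0 < b) : 0 < riccatiConst p b := by
  have h1 : 0 < p - 2 := by linarith
  have h2 : 0 < p - 1 := by linarith
  unfold riccatiConst
  positivity

theorem riccatiRate_pos {p b : ℝ} (hp : 2 < p) (hb : 0 < b) (s : ℝ) : 0 < riccatiRate p b s := by
  have h1 := riccatiConst_pos hp hb
  have h2 : 0 < p - 1 := by linarith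
  unfold riccatiRate
  positivity

/-- The odd solution of the Riccati equation blows up at the angle
`(π/2) ((1 + b) / √B - 1)`, `B = riccatiConst p b`; this inequality, saying that the angle exceeds
`π/2`, is the quadratic condition on `b` whose positive root is `β_p`. -/
theorem four_mul_riccatiConst_lt {p b : ℝ} (hp : 2 < p) (hb : 0 < b) (hbβ : b < betaExp p) :
    4 * riccatiConst p b < (1 + b) ^ 2 := by
  have h2 : p - 1 ≠ 0 := by linarith
  set r := 1 / (p - 1) with hr
  have e1 : riccatiConst p b = b ^ 2 + b * (1 - r) := by
    rw [riccatiConst, hr]; field_simp; ring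
  have e2 : betaExp p = -(1 / 3 - 2 / 3 * r) + √((1 / 3 - 2 / 3 * r) ^ 2 + 1 / 3) := by
    have : -(1 / 3) + 2 / (3 * (p - 1)) = -(1 / 3 - 2 / 3 * r) := by rw [hr]; field_simp; ring
    rw [betaExp, this, neg_sq]
  set c := 1 / 3 - 2 / 3 * r with hc
  have h3 : b + c < √(c ^ 2 + 1 / 3) := by rw [e2] at hbβ; linarith
  have h4 : b ^ 2 + 2 * b * c < 1 / 3 := by
    rcases le_or_gt 0 (b + c) with h | h
    · have := (Real.lt_sqrt h).1 h3
      nlinarith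
    · nlinarith
  rw [e1]
  have : c * 3 = 1 - 2 * r := by rw [hc]; ring
  nlinarith

theorem hasStrictDerivAt_riccatiAngle {p b : ℝ} (hp : 2 < p) (hb : 0 < b) (s : ℝ) :
    HasStrictDerivAt (riccatiAngle p b) (riccatiRate p b s)⁻¹ s := by
  have hB := riccatiConst_pos hp hb
  have h2 : 0 < p - 1 := by linarith
  have hq : 0 < √(riccatiConst p b) := Real.sqrt_pos.2 hB
  have hsq : √(riccatiConst p b) ^ 2 = riccatiConst p b := Real.sq_sqrt hB.le
  have d1 : HasStrictDerivAt (fun s : ℝ => Real.arctan (s / b)) (1 / (1 + (s / b) ^ 2) * (1 / b)) s :=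
    ((hasStrictDerivAt_id s).div_const b).arctan
  have d2 : HasStrictDerivAt (fun s : ℝ => Real.arctan (s / √(riccatiConst p b)))
      (1 / (1 + (s / √(riccatiConst p b)) ^ 2) * (1 / √(riccatiConst p b))) s :=
    ((hasStrictDerivAt_id s).div_const _).arctan
  have d := d1.neg.add (d2.const_mul ((1 + b) / √(riccatiConst p b)))
  refine d.congr_deriv ?_
  have e1 : 1 / (1 + (s / b) ^ 2) * (1 / b) = b / (s ^ 2 + b ^ 2) := by
    field_simp; ring
  have e2 : (1 + b) / √(riccatiConst p b) * (1 / (1 + (s / √(riccatiConst p b)) ^ 2)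
      * (1 / √(riccatiConst p b))) = (1 + b) / (s ^ 2 + riccatiConst p b) := by
    rw [div_pow, hsq]
    have : (1 + b) / √(riccatiConst p b) * (1 / (1 + s ^ 2 / riccatiConst p b)
      * (1 / √(riccatiConst p b))) = (1 + b) / (√(riccatiConst p b) ^ 2
        * (1 + s ^ 2 / riccatiConst p b)) := by field_simp
    rw [this, hsq]
    congr 1
    field_simp
    ring
  rw [e1, e2, riccatiRate, inv_div]
  have hk : (p - 1) * riccatiConst p b = (p - 1) * b ^ 2 + (p - 2) * b := by
    rw [riccatiConst]; field_simp
  have h3 : 0 < b ^ 2 + (p - 1) * s ^ 2 := by positivity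
  rw [eq_div_iff (by positivity)]
  have h4 : s ^ 2 + b ^ 2 ≠ 0 := by positivity
  have h5 : s ^ 2 + riccatiConst p b ≠ 0 := by positivity
  field_simp
  linear_combination (-b) * hk

/-- Below the critical exponent the Riccati equation has a solution on `(-π/2, π/2)` which stays
bounded. -/
theorem exists_riccati_solution {p b : ℝ} (hp : 2 < p) (hb : 0 < b) (hbβ : b < betaExp p) :
    ∃ (S : ℝ → ℝ) (s₀ : ℝ), ∀ θ ∈ Ioo (-(Real.pi / 2)) (Real.pi / 2),
      |S θ| ≤ s₀ ∧ HasDerivAt S (riccatiRate p b (S θ)) θ := by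
  have hB := riccatiConst_pos hp hb
  have hq : 0 < √(riccatiConst p b) := Real.sqrt_pos.2 hB
  have hderiv : ∀ s, HasDerivAt (riccatiAngle p b) (riccatiRate p b s)⁻¹ s := fun s =>
    (hasStrictDerivAt_riccatiAngle hp hb s).hasDerivAt
  have hcont : Continuous (riccatiAngle p b) :=
    continuous_iff_continuousAt.2 fun s => (hderiv s).continuousAt
  have hmono : StrictMono (riccatiAngle p b) := strictMono_of_deriv_pos fun s => by
    rw [(hderiv s).deriv]; exact inv_pos.2 (riccatiRate_pos hp hb s)
  have hodd : ∀ s, riccatiAngle p b (-s) = -riccatiAngle p b s := fun s => by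
    simp only [riccatiAngle, neg_div, Real.arctan_neg]; ring
  -- the angle exceeds `π/2` for large `s`
  obtain ⟨s₀, hs₀, hs₀0⟩ : ∃ s₀, Real.pi / 2 < riccatiAngle p b s₀ ∧ 0 ≤ s₀ := by
    have hlim : Tendsto (riccatiAngle p b) atTop
        (𝓝 (-(Real.pi / 2) + (1 + b) / √(riccatiConst p b) * (Real.pi / 2))) := by
      have h1 : ∀ c : ℝ, 0 < c → Tendsto (fun s : ℝ => Real.arctan (s / c)) atTop
          (𝓝 (Real.pi / 2)) := fun c hc =>
        (Real.tendsto_arctan_atTop.mono_right nhdsWithin_le_nhds).comp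
          (tendsto_id.atTop_div_const hc)
      exact (h1 b hb).neg.add ((h1 _ hq).const_mul _)
    have hgt : Real.pi / 2 < -(Real.pi / 2) + (1 + b) / √(riccatiConst p b) * (Real.pi / 2) := by
      have h2 : 2 < (1 + b) / √(riccatiConst p b) := by
        rw [lt_div_iff₀ hq]
        have h3 := four_mul_riccatiConst_lt hp hb hbβ
        refine lt_of_pow_lt_pow_left₀ 2 (by positivity) ?_
        rw [mul_pow, Real.sq_sqrt hB.le]
        linarith
      nlinarith [Real.pi_pos]
    exact ((hlim.eventually (lt_mem_nhds hgt)).and (eventually_ge_atTop 0)).exists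
  have hinv : ∀ s, Function.invFun (riccatiAngle p b) (riccatiAngle p b s) = s :=
    Function.leftInverse_invFun hmono.injective
  refine ⟨Function.invFun (riccatiAngle p b), s₀, fun θ hθ => ?_⟩
  obtain ⟨s, hs, rfl⟩ : ∃ s ∈ Icc (-s₀) s₀, riccatiAngle p b s = θ := by
    refine intermediate_value_Icc (by linarith) hcont.continuousOn ⟨?_, ?_⟩
    · rw [hodd]; linarith [hθ.1]
    · linarith [hθ.2]
  rw [hinv]
  refine ⟨abs_le.2 hs, ?_⟩
  have := (hasStrictDerivAt_riccatiAngle hp hb s).to_local_left_inverse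
    (inv_ne_zero (riccatiRate_pos hp hb s).ne') (Eventually.of_forall hinv)
  rw [inv_inv] at this
  exact this.hasDerivAt

/-! ### The singular planar solution in Cartesian coordinates -/

/-- The logarithm of `r^{-b} f(θ)` at the point `(X, Y)`, where `s = -f'/f` has the value `σ` at
`θ = arctan (X / Y)`, the angle from the `Y`-axis. -/
def planarLog (p b σ X Y : ℝ) : ℝ :=
  -(b / 2) * Real.log (X ^ 2 + Y ^ 2) + b / 2 * Real.log (σ ^ 2 + b ^ 2)
    - (1 + b) / 2 * Real.log (σ ^ 2 + riccatiConst p b)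

/-- The `X`-derivative of `planarLog` along a solution of the Riccati equation. -/
def planarLogDX (b σ X Y : ℝ) : ℝ := -(b * X + σ * Y) / (X ^ 2 + Y ^ 2)

/-- The `Y`-derivative of `planarLog` along a solution of the Riccati equation. -/
def planarLogDY (b σ X Y : ℝ) : ℝ := (σ * X - b * Y) / (X ^ 2 + Y ^ 2)

/-- The logarithm of `|∇V|^{p-2} V` for `V = exp planarLog`. -/
def planarWeight (p b σ X Y : ℝ) : ℝ :=
  (p - 1) * planarLog p b σ X Y
    + (p - 2) / 2 * (Real.log (σ ^ 2 + b ^ 2) - Real.log (X ^ 2 + Y ^ 2))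

section Derivatives

variable {p b : ℝ} {σ X Y : ℝ → ℝ} {ξ η t : ℝ}

theorem hasDerivAt_riccati_arctan {S : ℝ → ℝ}
    (hS : ∀ θ ∈ Ioo (-(Real.pi / 2)) (Real.pi / 2), HasDerivAt S (riccatiRate p b (S θ)) θ)
    (hX : HasDerivAt X ξ t) (hY : HasDerivAt Y η t) (hY0 : 0 < Y t) :
    HasDerivAt (fun t => S (Real.arctan (X t / Y t)))
      (riccatiRate p b (S (Real.arctan (X t / Y t))) *
        ((Y t * ξ - X t * η) / (X t ^ 2 + Y t ^ 2))) t := by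
  have h1 := (hX.div hY hY0.ne').arctan
  have h2 := (hS _ ⟨Real.neg_pi_div_two_lt_arctan (X t / Y t),
    Real.arctan_lt_pi_div_two (X t / Y t)⟩).comp t h1
  refine h2.congr_deriv ?_
  have : X t ^ 2 + Y t ^ 2 ≠ 0 := by positivity
  congr 1
  simp only [Pi.div_apply]
  field_simp
  ring

theorem hasDerivAt_planarLog (hp : 2 < p) (hb : 0 < b)
    (hσ : HasDerivAt σ (riccatiRate p b (σ t) *
      ((Y t * ξ - X t * η) / (X t ^ 2 + Y t ^ 2))) t)
    (hX : HasDerivAt X ξ t) (hY : HasDerivAt Y η t) (hY0 : 0 < Y t) :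
    HasDerivAt (fun t => planarLog p b (σ t) (X t) (Y t))
      (planarLogDX b (σ t) (X t) (Y t) * ξ + planarLogDY b (σ t) (X t) (Y t) * η) t := by
  have hB := riccatiConst_pos hp hb
  have hR : X t ^ 2 + Y t ^ 2 ≠ 0 := by positivity
  have ha : σ t ^ 2 + b ^ 2 ≠ 0 := by positivity
  have hβ : σ t ^ 2 + riccatiConst p b ≠ 0 := by positivity
  have d1 := ((hX.pow 2).add (hY.pow 2)).log hR
  have d2 := ((hσ.pow 2).add_const (b ^ 2)).log ha
  have d3 := ((hσ.pow 2).add_const (riccatiConst p b)).log hβ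
  have d := ((d1.const_mul (-(b / 2))).add (d2.const_mul (b / 2))).sub
    (d3.const_mul ((1 + b) / 2))
  refine d.congr_deriv ?_
  have hr : (b * σ t / (σ t ^ 2 + b ^ 2) - (1 + b) * σ t / (σ t ^ 2 + riccatiConst p b))
      * riccatiRate p b (σ t) = -σ t := by
    have h2 : 0 < p - 1 := by linarith
    have h3 : b ^ 2 + (p - 1) * σ t ^ 2 ≠ 0 := by positivity
    have hk : (p - 1) * riccatiConst p b = (p - 1) * b ^ 2 + (p - 2) * b := by
      rw [riccatiConst]; field_simp
    rw [riccatiRate]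
    field_simp
    linear_combination (b * σ t) * hk
  simp only [Nat.cast_ofNat, Nat.add_one_sub_one, pow_one, planarLogDX, planarLogDY, Pi.add_apply,
    Pi.pow_apply]
  set A := (Y t * ξ - X t * η) / (X t ^ 2 + Y t ^ 2) with hA
  have e : -(b / 2) * ((2 * X t * ξ + 2 * Y t * η) / (X t ^ 2 + Y t ^ 2))
      + b / 2 * (2 * σ t * (riccatiRate p b (σ t) * A) / (σ t ^ 2 + b ^ 2))
      - (1 + b) / 2 * (2 * σ t * (riccatiRate p b (σ t) * A) / (σ t ^ 2 + riccatiConst p b))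
      = -b * ((X t * ξ + Y t * η) / (X t ^ 2 + Y t ^ 2))
        + ((b * σ t / (σ t ^ 2 + b ^ 2) - (1 + b) * σ t / (σ t ^ 2 + riccatiConst p b))
      * riccatiRate p b (σ t)) * A := by ring
  rw [e, hr, hA]
  field_simp
  ring

theorem hasDerivAt_planarLogDX {σ' : ℝ} (hσ : HasDerivAt σ σ' t)
    (hX : HasDerivAt X ξ t) (hY : HasDerivAt Y η t) (hY0 : 0 < Y t) :
    HasDerivAt (fun t => planarLogDX b (σ t) (X t) (Y t))
      ((-(b * ξ + (σ' * Y t + σ t * η)) * (X t ^ 2 + Y t ^ 2)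
        - -(b * X t + σ t * Y t) * (2 * X t * ξ + 2 * Y t * η)) / (X t ^ 2 + Y t ^ 2) ^ 2) t := by
  have hR : X t ^ 2 + Y t ^ 2 ≠ 0 := by positivity
  refine ((((hX.const_mul b).add (hσ.mul hY)).neg.div ((hX.pow 2).add (hY.pow 2)) hR)).congr_deriv ?_
  simp

theorem hasDerivAt_planarLogDY {σ' : ℝ} (hσ : HasDerivAt σ σ' t)
    (hX : HasDerivAt X ξ t) (hY : HasDerivAt Y η t) (hY0 : 0 < Y t) :
    HasDerivAt (fun t => planarLogDY b (σ t) (X t) (Y t))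
      (((σ' * X t + σ t * ξ - b * η) * (X t ^ 2 + Y t ^ 2)
        - (σ t * X t - b * Y t) * (2 * X t * ξ + 2 * Y t * η)) / (X t ^ 2 + Y t ^ 2) ^ 2) t := by
  have hR : X t ^ 2 + Y t ^ 2 ≠ 0 := by positivity
  refine ((((hσ.mul hX).sub (hY.const_mul b)).div ((hX.pow 2).add (hY.pow 2)) hR)).congr_deriv ?_
  simp

theorem hasDerivAt_planarWeight (hp : 2 < p) (hb : 0 < b) {σ' : ℝ} (hσ' : HasDerivAt σ σ' t)
    (hσ : σ' = riccatiRate p b (σ t) * ((Y t * ξ - X t * η) / (X t ^ 2 + Y t ^ 2)))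
    (hX : HasDerivAt X ξ t) (hY : HasDerivAt Y η t) (hY0 : 0 < Y t) :
    HasDerivAt (fun t => planarWeight p b (σ t) (X t) (Y t))
      ((p - 1) * (planarLogDX b (σ t) (X t) (Y t) * ξ + planarLogDY b (σ t) (X t) (Y t) * η)
        + (p - 2) / 2 * (2 * σ t * σ' / (σ t ^ 2 + b ^ 2)
          - (2 * X t * ξ + 2 * Y t * η) / (X t ^ 2 + Y t ^ 2))) t := by
  have hR : X t ^ 2 + Y t ^ 2 ≠ 0 := by positivity
  have ha : σ t ^ 2 + b ^ 2 ≠ 0 := by positivity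
  have d1 := ((hX.pow 2).add (hY.pow 2)).log hR
  have d2 := ((hσ'.pow 2).add_const (b ^ 2)).log ha
  have d3 := hasDerivAt_planarLog hp hb (hσ ▸ hσ') hX hY hY0
  refine ((d3.const_mul (p - 1)).add ((d2.sub d1).const_mul ((p - 2) / 2))).congr_deriv ?_
  simp

/-- The divergence of the vector field `|∇V|^{p-2} ∇V` vanishes; here `E = |∇V|^{p-2} V`,
`s = riccatiRate p b σ`, and each summand is an application of the product rule. -/
theorem planar_divergence_eq_zero (hp : 2 < p) (hb : 0 < b) (σ X Y E : ℝ) (hY : 0 < Y) :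
    let R := X ^ 2 + Y ^ 2
    let s₁ := riccatiRate p b σ * ((Y * 1 - X * 0) / R)
    let s₂ := riccatiRate p b σ * ((Y * 0 - X * 1) / R)
    (E * ((p - 1) * (planarLogDX b σ X Y * 1 + planarLogDY b σ X Y * 0)
        + (p - 2) / 2 * (2 * σ * s₁ / (σ ^ 2 + b ^ 2) - (2 * X * 1 + 2 * Y * 0) / R))
        * planarLogDX b σ X Y
      + E * ((-(b * 1 + (s₁ * Y + σ * 0)) * R
        - -(b * X + σ * Y) * (2 * X * 1 + 2 * Y * 0)) / R ^ 2))
    + (E * ((p - 1) * (planarLogDX b σ X Y * 0 + planarLogDY b σ X Y * 1)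
        + (p - 2) / 2 * (2 * σ * s₂ / (σ ^ 2 + b ^ 2) - (2 * X * 0 + 2 * Y * 1) / R))
        * planarLogDY b σ X Y
      + E * (((s₂ * X + σ * 0 - b * 1) * R
        - (σ * X - b * Y) * (2 * X * 0 + 2 * Y * 1)) / R ^ 2)) = 0 := by
  intro R s₁ s₂
  have hR : R ≠ 0 := by positivity
  have ha : σ ^ 2 + b ^ 2 ≠ 0 := by positivity
  have h2 : 0 < p - 1 := by linarith
  have h3 : b ^ 2 + (p - 1) * σ ^ 2 ≠ 0 := by positivity
  have hk : (p - 1) * riccatiConst p b = (p - 1) * b ^ 2 + (p - 2) * b := by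
    rw [riccatiConst]; field_simp
  -- the Riccati equation, cleared of denominators
  have hD : riccatiRate p b σ * (b ^ 2 + (p - 1) * σ ^ 2)
      = (σ ^ 2 + b ^ 2) * ((p - 1) * (σ ^ 2 + b ^ 2) + (p - 2) * b) := by
    rw [riccatiRate, div_mul_cancel₀ _ h3]
    linear_combination (σ ^ 2 + b ^ 2) * hk
  set D := riccatiRate p b σ
  have hRX : X ^ 2 + Y ^ 2 = R := rfl
  have key : (p - 1) * (σ ^ 2 + b ^ 2) + (p - 2) * b - (p - 2) * σ ^ 2 * D / (σ ^ 2 + b ^ 2) - D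
      = 0 := by
    field_simp
    linear_combination -hD
  have e1 : s₁ = D * Y / R := by simp only [s₁]; ring
  have e2 : s₂ = -(D * X / R) := by simp only [s₂]; ring
  rw [e1, e2]
  simp only [planarLogDX, planarLogDY, hRX]
  have : ∀ Z : ℝ, Z = E / R * ((p - 1) * (σ ^ 2 + b ^ 2) + (p - 2) * b
      - (p - 2) * σ ^ 2 * D / (σ ^ 2 + b ^ 2) - D) → Z = 0 := fun Z hZ => by
    rw [hZ, key, mul_zero]
  apply this
  simp only [R]
  have hR' : X ^ 2 + Y ^ 2 ≠ 0 := hR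
  field_simp
  ring

end Derivatives

/-! ### The barrier in the half-space -/

/-- The field `a e_0 + c e_n` in `ℝⁿ`. -/
def planeField (n : ℕ) (hn : 2 ≤ n) (a c : ℝ) : EuclideanSpace ℝ (Fin n) :=
  a • EuclideanSpace.single ⟨0, by omega⟩ 1 + c • EuclideanSpace.single (lastIdx n hn) 1

theorem inner_planeField {n : ℕ} (hn : 2 ≤ n) (a c : ℝ) (v : EuclideanSpace ℝ (Fin n)) :
    inner ℝ (planeField n hn a c) v = a * v ⟨0, by omega⟩ + c * v (lastIdx n hn) := by
  simp [planeField, inner_add_left, real_inner_smul_left, EuclideanSpace.inner_single_left]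

theorem zero_ne_lastIdx {n : ℕ} (hn : 2 ≤ n) : (⟨0, by omega⟩ : Fin n) ≠ lastIdx n hn := by
  simp only [lastIdx, ne_eq, Fin.mk.injEq]
  omega

theorem norm_planeField_sq {n : ℕ} (hn : 2 ≤ n) (a c : ℝ) :
    ‖planeField n hn a c‖ ^ 2 = a ^ 2 + c ^ 2 := by
  rw [← real_inner_self_eq_norm_sq, inner_planeField]
  have h := zero_ne_lastIdx hn
  simp [planeField, h, h.symm]
  ring

theorem sq_add_sq_le_norm_sq {n : ℕ} (hn : 2 ≤ n) (x : EuclideanSpace ℝ (Fin n)) :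
    x ⟨0, by omega⟩ ^ 2 + x (lastIdx n hn) ^ 2 ≤ ‖x‖ ^ 2 := by
  rw [EuclideanSpace.real_norm_sq_eq, ← Finset.sum_pair (zero_ne_lastIdx hn) (f := fun i => x i ^ 2)]
  exact Finset.sum_le_sum_of_subset_of_nonneg (Finset.subset_univ _) fun i _ _ => sq_nonneg _

theorem isOpen_upperHalf {n : ℕ} (hn : 2 ≤ n) : IsOpen (upperHalf n hn) :=
  isOpen_lt continuous_const (by fun_prop)

/-- In the half-space there is, for each positive exponent `b` below the critical one, a positive
`p`-harmonic function bounded below by a multiple of `|x|^{-b}`. It depends only on the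
coordinates `x_0` and `x_n`, and is singular on their common zero set. -/
theorem exists_barrier {n : ℕ} (hn : 2 ≤ n) {p b : ℝ} (hp : 2 < p) (hb : 0 < b)
    (hbβ : b < betaExp p) :
    ∃ (V : EuclideanSpace ℝ (Fin n) → ℝ)
      (G : EuclideanSpace ℝ (Fin n) → EuclideanSpace ℝ (Fin n)) (κ : ℝ),
      0 < κ ∧ ContinuousOn V (upperHalf n hn) ∧ ContinuousOn G (upperHalf n hn) ∧
      (∀ x ∈ upperHalf n hn, ∀ v, HasLineDerivAt ℝ V (inner ℝ (G x) v) x v) ∧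
      (∀ φ, IsTestFunction (upperHalf n hn) φ →
        ∫ x in upperHalf n hn, ‖G x‖ ^ (p - 2) * inner ℝ (G x) (gradient φ x) = 0) ∧
      ∀ x ∈ upperHalf n hn, κ * ‖x‖ ^ (-b) ≤ V x := by
  obtain ⟨S, s₀, hS⟩ := exists_riccati_solution hp hb hbβ
  have hS' : ∀ θ ∈ Ioo (-(Real.pi / 2)) (Real.pi / 2),
      HasDerivAt S (riccatiRate p b (S θ)) θ := fun θ hθ => (hS θ hθ).2
  have hB := riccatiConst_pos hp hb
  set Ω := upperHalf n hn with hΩdef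
  set i : Fin n := ⟨0, by omega⟩ with hi
  set l : Fin n := lastIdx n hn with hl
  have hΩ : ∀ x ∈ Ω, 0 < x l := fun x hx => hx
  set σ : EuclideanSpace ℝ (Fin n) → ℝ := fun x => S (Real.arctan (x i / x l)) with hσ
  set V : EuclideanSpace ℝ (Fin n) → ℝ :=
    fun x => Real.exp (planarLog p b (σ x) (x i) (x l)) with hV
  set α : EuclideanSpace ℝ (Fin n) → ℝ := fun x => planarLogDX b (σ x) (x i) (x l) with hα
  set γ : EuclideanSpace ℝ (Fin n) → ℝ := fun x => planarLogDY b (σ x) (x i) (x l) with hγ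
  set P : EuclideanSpace ℝ (Fin n) → ℝ :=
    fun x => Real.exp (planarWeight p b (σ x) (x i) (x l)) with hP
  set G : EuclideanSpace ℝ (Fin n) → EuclideanSpace ℝ (Fin n) :=
    fun x => planeField n hn (V x * α x) (V x * γ x) with hG
  have hR : ∀ x ∈ Ω, x i ^ 2 + x l ^ 2 ≠ 0 := fun x hx => by
    have := hΩ x hx; positivity
  have ha : ∀ s : ℝ, s ^ 2 + b ^ 2 ≠ 0 := fun s => by positivity
  have hβ : ∀ s : ℝ, s ^ 2 + riccatiConst p b ≠ 0 := fun s => by positivity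
  -- continuity of all ingredients
  have cσ : ContinuousOn σ Ω := by
    have h1 : ContinuousOn (fun x : EuclideanSpace ℝ (Fin n) => Real.arctan (x i / x l)) Ω :=
      Real.continuous_arctan.comp_continuousOn
        (ContinuousOn.div (by fun_prop) (by fun_prop) fun x hx => (hΩ x hx).ne')
    have h2 : ContinuousOn S (Ioo (-(Real.pi / 2)) (Real.pi / 2)) := fun θ hθ =>
      (hS' θ hθ).continuousAt.continuousWithinAt
    exact h2.comp h1 fun x _ => ⟨Real.neg_pi_div_two_lt_arctan _, Real.arctan_lt_pi_div_two _⟩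
  have cR : ContinuousOn (fun x : EuclideanSpace ℝ (Fin n) => x i ^ 2 + x l ^ 2) Ω := by fun_prop
  have cX : ContinuousOn (fun x : EuclideanSpace ℝ (Fin n) => x i) Ω := by fun_prop
  have cY : ContinuousOn (fun x : EuclideanSpace ℝ (Fin n) => x l) Ω := by fun_prop
  have clR := cR.log hR
  have cla := ((cσ.pow 2).add (continuousOn_const (c := b ^ 2))).log fun x _ => ha (σ x)
  have cL : ContinuousOn (fun x => planarLog p b (σ x) (x i) (x l)) Ω := by
    have h3 := ((cσ.pow 2).add (continuousOn_const (c := riccatiConst p b))).log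
      fun x _ => hβ (σ x)
    exact ((clR.const_mul (-(b / 2))).add (cla.const_mul (b / 2))).sub (h3.const_mul ((1 + b) / 2))
  have cV : ContinuousOn V Ω := cL.rexp
  have cα : ContinuousOn α Ω := (((cX.const_mul b).add (cσ.mul cY)).neg.div cR hR)
  have cγ : ContinuousOn γ Ω := (((cσ.mul cX).sub (cY.const_mul b)).div cR hR)
  have cP : ContinuousOn P Ω :=
    ((cL.const_mul (p - 1)).add ((cla.sub clR).const_mul ((p - 2) / 2))).rexp
  have cG : ContinuousOn G Ω :=
    ((cV.mul cα).smul continuousOn_const).add ((cV.mul cγ).smul continuousOn_const)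
  -- derivatives along lines
  have line : ∀ (x v : EuclideanSpace ℝ (Fin n)) (j : Fin n),
      HasDerivAt (fun t : ℝ => (x + t • v) j) (v j) 0 := fun x v j => by
    have := ((hasDerivAt_id (0 : ℝ)).mul_const (v j)).const_add (x j)
    simpa using this
  have lσ : ∀ x ∈ Ω, ∀ v : EuclideanSpace ℝ (Fin n),
      HasDerivAt (fun t : ℝ => σ (x + t • v))
        (riccatiRate p b (σ x) * ((x l * v i - x i * v l) / (x i ^ 2 + x l ^ 2))) 0 := by
    intro x hx v
    have := hasDerivAt_riccati_arctan hS' (line x v i) (line x v l) (by simpa using hΩ x hx)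
    simp only [zero_smul, add_zero] at this
    exact this
  have lV : ∀ x ∈ Ω, ∀ v, HasLineDerivAt ℝ V (inner ℝ (G x) v) x v := by
    intro x hx v
    have := (hasDerivAt_planarLog hp hb (σ := fun t => σ (x + t • v))
      (by simpa only [zero_smul, add_zero] using lσ x hx v) (line x v i) (line x v l) (by simpa using hΩ x hx)).exp
    simp only [zero_smul, add_zero] at this
    refine HasDerivAt.congr_deriv this ?_
    rw [hG, inner_planeField]
    simp only [hV, hα, hγ]
    ring
  have lP : ∀ x ∈ Ω, ∀ v : EuclideanSpace ℝ (Fin n), ∀ s',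
      s' = riccatiRate p b (σ x) * ((x l * v i - x i * v l) / (x i ^ 2 + x l ^ 2)) →
      HasDerivAt (fun t : ℝ => P (x + t • v)) (P x * ((p - 1) * (α x * v i + γ x * v l)
        + (p - 2) / 2 * (2 * σ x * s' / (σ x ^ 2 + b ^ 2)
          - (2 * x i * v i + 2 * x l * v l) / (x i ^ 2 + x l ^ 2)))) 0 := by
    intro x hx v s' hs'
    have := (hasDerivAt_planarWeight hp hb (σ := fun t => σ (x + t • v)) (σ' := s')
      (by rw [hs']; exact lσ x hx v) (by simpa only [zero_smul, add_zero] using hs') (line x v i) (line x v l) (by simpa using hΩ x hx)).exp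
    simp only [zero_smul, add_zero] at this
    exact this
  have lα : ∀ x ∈ Ω, ∀ v : EuclideanSpace ℝ (Fin n), _ := fun x hx v =>
    hasDerivAt_planarLogDX (b := b) (lσ x hx v) (line x v i) (line x v l) (by simpa using hΩ x hx)
  have lγ : ∀ x ∈ Ω, ∀ v : EuclideanSpace ℝ (Fin n), _ := fun x hx v =>
    hasDerivAt_planarLogDY (b := b) (lσ x hx v) (line x v i) (line x v l) (by simpa using hΩ x hx)
  simp only [zero_smul, add_zero] at lα lγ
  -- the length of the gradient
  have hnorm : ∀ x ∈ Ω, ‖G x‖ ^ (p - 2) * V x = P x := by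
    intro x hx
    have hR0 : 0 < x i ^ 2 + x l ^ 2 := by have := hΩ x hx; positivity
    have ha0 : 0 < σ x ^ 2 + b ^ 2 := by positivity
    have h1 : ‖G x‖ ^ 2 = Real.exp (2 * planarLog p b (σ x) (x i) (x l)
        + (Real.log (σ x ^ 2 + b ^ 2) - Real.log (x i ^ 2 + x l ^ 2))) := by
      rw [hG, norm_planeField_sq, Real.exp_add, Real.exp_sub, Real.exp_log hR0, Real.exp_log ha0,
        two_mul, Real.exp_add]
      simp only [hV, hα, hγ, planarLogDX, planarLogDY]
      field_simp
      ring
    have h2 : ‖G x‖ ^ (p - 2) = (‖G x‖ ^ 2) ^ ((p - 2) / 2) := by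
      rw [← Real.rpow_natCast, ← Real.rpow_mul (norm_nonneg _)]
      congr 1
      push_cast
      ring
    rw [h2, h1, ← Real.exp_mul, hV, ← Real.exp_add, hP]
    simp only [planarWeight]
    congr 1
    ring
  refine ⟨V, G, Real.exp (b / 2 * Real.log (b ^ 2)
    - (1 + b) / 2 * Real.log (s₀ ^ 2 + riccatiConst p b)), Real.exp_pos _, cV, cG, lV, ?_, ?_⟩
  · -- the equation in divergence form
    intro φ hφ
    have hil : i ≠ l := zero_ne_lastIdx hn
    set ei : EuclideanSpace ℝ (Fin n) := EuclideanSpace.single i 1 with hei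
    set el : EuclideanSpace ℝ (Fin n) := EuclideanSpace.single l 1 with hel
    have ei_i : ei i = 1 := by simp [hei]
    have ei_l : ei l = 0 := by simp [hei, hil.symm]
    have el_i : el i = 0 := by simp [hel, hil]
    have el_l : el l = 1 := by simp [hel]
    set R : EuclideanSpace ℝ (Fin n) → ℝ := fun x => x i ^ 2 + x l ^ 2
    set s₁ : EuclideanSpace ℝ (Fin n) → ℝ :=
      fun x => riccatiRate p b (σ x) * ((x l * 1 - x i * 0) / R x) with hs₁
    -- the derivative of the first component in its own direction
    set d : EuclideanSpace ℝ (Fin n) → ℝ := fun x =>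
      P x * ((p - 1) * (α x * 1 + γ x * 0)
        + (p - 2) / 2 * (2 * σ x * s₁ x / (σ x ^ 2 + b ^ 2) - (2 * x i * 1 + 2 * x l * 0) / R x))
        * α x
      + P x * ((-(b * 1 + (s₁ x * x l + σ x * 0)) * R x
        - -(b * x i + σ x * x l) * (2 * x i * 1 + 2 * x l * 0)) / R x ^ 2) with hd
    have cs₁ : ContinuousOn s₁ Ω := by
      have hden : ∀ x ∈ Ω, b ^ 2 + (p - 1) * σ x ^ 2 ≠ 0 := fun x _ => by
        have : 0 < p - 1 := by linarith
        positivity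
      have h1 : ContinuousOn (fun x => riccatiRate p b (σ x)) Ω := by
        unfold riccatiRate
        fun_prop (disch := assumption)
      have h2 : ContinuousOn (fun x : EuclideanSpace ℝ (Fin n) => (x l * 1 - x i * 0) / R x) Ω :=
        ContinuousOn.div (by fun_prop) cR hR
      exact h1.mul h2
    have cd : ContinuousOn d Ω := by
      have h1 : ContinuousOn (fun x => 2 * σ x * s₁ x / (σ x ^ 2 + b ^ 2)) Ω :=
        ContinuousOn.div (by fun_prop) (by fun_prop) fun x _ => ha (σ x)
      have h2 : ContinuousOn (fun x : EuclideanSpace ℝ (Fin n) =>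
          (2 * x i * 1 + 2 * x l * 0) / R x) Ω := ContinuousOn.div (by fun_prop) cR hR
      have h3 : ContinuousOn (fun x => (-(b * 1 + (s₁ x * x l + σ x * 0)) * R x
        - -(b * x i + σ x * x l) * (2 * x i * 1 + 2 * x l * 0)) / R x ^ 2) Ω :=
        ContinuousOn.div (by fun_prop) (by fun_prop) fun x hx => pow_ne_zero 2 (hR x hx)
      fun_prop
    have l₁ : ∀ x ∈ Ω, HasLineDerivAt ℝ (fun x => P x * α x) (d x) x ei := by
      intro x hx
      have h1 := (lP x hx ei _ rfl).mul (lα x hx ei)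
      simp only [ei_i, ei_l, zero_smul, add_zero] at h1
      exact h1
    have l₂ : ∀ x ∈ Ω, HasLineDerivAt ℝ (fun x => P x * γ x) (-d x) x el := by
      intro x hx
      have h1 := (lP x hx el _ rfl).mul (lγ x hx el)
      simp only [el_i, el_l, zero_smul, add_zero] at h1
      refine HasDerivAt.congr_deriv h1 ?_
      have h2 := planar_divergence_eq_zero hp hb (σ x) (x i) (x l) (P x) (hΩ x hx)
      exact (neg_eq_of_add_eq_zero_right h2).symm
    have cPα : ContinuousOn (fun x => P x * α x) Ω := cP.mul cα
    have cPγ : ContinuousOn (fun x => P x * γ x) Ω := cP.mul cγ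
    have i₁ := integral_mul_fderiv_of_hasLineDerivAt cPα cd l₁ hφ
    have i₂ := integral_mul_fderiv_of_hasLineDerivAt (f' := fun x => -d x) cPγ cd.neg l₂ hφ
    have hint : ∀ (f : EuclideanSpace ℝ (Fin n) → ℝ) (v : EuclideanSpace ℝ (Fin n)),
        ContinuousOn f Ω → Integrable (fun x => f x * fderiv ℝ φ x v) (volume.restrict Ω) := by
      intro f v hf
      have := (hf.memLpLoc 1).integrable_inner (ψ := fun x => fderiv ℝ φ x v)
        ((hφ.smooth.continuous_fderiv (by simp)).clm_apply continuous_const) hφ.compactSupport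
        hφ.tsupport_subset (fun x hx => by simp [fderiv_eq_zero_of_notMem_tsupport hx])
      refine this.congr (Eventually.of_forall fun x => ?_)
      simp [mul_comm]
    have hsplit : ∫ x in Ω, ‖G x‖ ^ (p - 2) * inner ℝ (G x) (gradient φ x)
        = ∫ x in Ω, (P x * α x * fderiv ℝ φ x ei + P x * γ x * fderiv ℝ φ x el) := by
      refine setIntegral_congr_fun (isOpen_upperHalf hn).measurableSet fun x hx => ?_
      rw [← hnorm x hx, real_inner_comm, inner_gradient_left, hG]
      simp only [planeField, map_add, map_smul, smul_eq_mul]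
      ring
    rw [hsplit, integral_add (hint _ ei cPα) (hint _ el cPγ)]
    have e : ∫ x in Ω, -d x * φ x = - ∫ x in Ω, d x * φ x := by
      simp only [neg_mul, integral_neg]
    rw [i₁, i₂, e]
    ring
  · intro x hx
    have hR0 : 0 < x i ^ 2 + x l ^ 2 := by have := hΩ x hx; positivity
    have hx0 : 0 < ‖x‖ := by
      rw [norm_pos_iff]
      rintro rfl
      exact lt_irrefl _ (hΩ 0 hx)
    rw [Real.rpow_def_of_pos hx0, ← Real.exp_add]
    refine Real.exp_le_exp.2 ?_
    have h1 : Real.log (x i ^ 2 + x l ^ 2) ≤ 2 * Real.log ‖x‖ := by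
      rw [← Nat.cast_ofNat (R := ℝ), ← Real.log_pow]
      exact Real.log_le_log hR0 (sq_add_sq_le_norm_sq hn x)
    have h2 : Real.log (b ^ 2) ≤ Real.log (σ x ^ 2 + b ^ 2) :=
      Real.log_le_log (by positivity) (by linarith [sq_nonneg (σ x)])
    have h3 : Real.log (σ x ^ 2 + riccatiConst p b) ≤ Real.log (s₀ ^ 2 + riccatiConst p b) := by
      refine Real.log_le_log (by positivity) ?_
      have := (hS (Real.arctan (x i / x l)) ⟨Real.neg_pi_div_two_lt_arctan _,
        Real.arctan_lt_pi_div_two _⟩).1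
      have := sq_le_sq' (abs_le.1 this).1 (abs_le.1 this).2
      linarith
    have h1' := mul_le_mul_of_nonneg_left h1 (by positivity : 0 ≤ b / 2)
    have h2' := mul_le_mul_of_nonneg_left h2 (by positivity : 0 ≤ b / 2)
    have h3' := mul_le_mul_of_nonneg_left h3 (by positivity : 0 ≤ (1 + b) / 2)
    simp only [planarLog]
    linarith

/-! ### The Phragmén–Lindelöf argument -/

theorem IsPHarmonic.one_add_mul {n : ℕ} {Ω : Set (EuclideanSpace ℝ (Fin n))} {p ε : ℝ}
    (hε : 0 < ε) {V : EuclideanSpace ℝ (Fin n) → ℝ}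
    {G : EuclideanSpace ℝ (Fin n) → EuclideanSpace ℝ (Fin n)}
    (hV : ContinuousOn V Ω) (hG : ContinuousOn G Ω)
    (hd : ∀ x ∈ Ω, ∀ v, HasLineDerivAt ℝ V (inner ℝ (G x) v) x v)
    (heq : ∀ φ, IsTestFunction Ω φ →
      ∫ x in Ω, ‖G x‖ ^ (p - 2) * inner ℝ (G x) (gradient φ x) = 0) :
    IsPHarmonic p Ω (fun x => 1 + ε * V x) := by
  have hW : ContinuousOn (fun x => 1 + ε * V x) Ω := continuousOn_const.add (hV.const_mul ε)
  have hG' : ContinuousOn (fun x => ε • G x) Ω := hG.const_smul ε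
  refine ⟨fun x => ε • G x, .of_hasLineDerivAt hW hG' fun x hx v => ?_, hW.memLpLoc p,
    hG'.memLpLoc p, fun φ hφ => ?_⟩
  · have : HasDerivAt (fun t : ℝ => V (x + t • v)) (inner ℝ (G x) v) 0 := hd x hx v
    refine HasDerivAt.congr_deriv ((this.const_mul ε).const_add 1) ?_
    rw [real_inner_smul_left]
  · have : ∀ x, ‖ε • G x‖ ^ (p - 2) * inner ℝ (ε • G x) (gradient φ x)
        = ε ^ (p - 2) * ε * (‖G x‖ ^ (p - 2) * inner ℝ (G x) (gradient φ x)) := fun x => by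
      rw [norm_smul, Real.norm_of_nonneg hε.le, Real.mul_rpow hε.le (norm_nonneg _),
        real_inner_smul_left]
      ring
    simp only [this]
    rw [integral_const_mul, heq φ hφ, mul_zero]

theorem betaExp_pos (p : ℝ) : 0 < betaExp p := by
  unfold betaExp
  set c := -(1 / 3) + 2 / (3 * (p - 1))
  have : |c| < √(c ^ 2 + 1 / 3) := by
    rw [← Real.sqrt_sq_eq_abs]
    exact Real.sqrt_lt_sqrt (sq_nonneg c) (by linarith)
  linarith [neg_abs_le c]

/-- The contact set of `u` with `1 + εV` is compact in the open half-space: near the origin `εV`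
dominates the growth of `u`, on the flat boundary `u` vanishes, and far away `u ≤ 1`. -/
theorem isCompact_contact_set {n : ℕ} (hn : 2 ≤ n) {β b κ ε : ℝ} (hβb : β < b) (hκ : 0 < κ)
    (hε : 0 < ε) {u V : EuclideanSpace ℝ (Fin n) → ℝ}
    (hcont : ContinuousOn u (closedUpperHalfPunctured n hn))
    (hzero : ∀ x : EuclideanSpace ℝ (Fin n), x (lastIdx n hn) = 0 → x ≠ 0 → u x = 0)
    (hout : ∀ x ∈ closedUpperHalfPunctured n hn, 1 ≤ ‖x‖ → |u x| ≤ 1)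
    (hin : ∀ x ∈ closedUpperHalfPunctured n hn, ‖x‖ ≤ 1 → |u x| ≤ ‖x‖ ^ (-β))
    (hV : ContinuousOn V (upperHalf n hn))
    (hVκ : ∀ x ∈ upperHalf n hn, κ * ‖x‖ ^ (-b) ≤ V x) :
    IsCompact {x ∈ upperHalf n hn | 1 + ε * V x ≤ u x} := by
  have hne : ∀ x ∈ upperHalf n hn, x ≠ 0 := by
    rintro x hx rfl
    exact lt_irrefl _ (show (0 : ℝ) < (0 : EuclideanSpace ℝ (Fin n)) (lastIdx n hn) from hx)
  have hsub : upperHalf n hn ⊆ closedUpperHalfPunctured n hn := fun x hx =>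
    ⟨le_of_lt hx, hne x hx⟩
  have hVpos : ∀ x ∈ upperHalf n hn, 0 < V x := fun x hx =>
    lt_of_lt_of_le (mul_pos hκ (Real.rpow_pos_of_pos (norm_pos_iff.2 (hne x hx)) _)) (hVκ x hx)
  have hle : ∀ x ∈ upperHalf n hn, 1 + ε * V x ≤ u x → ‖x‖ ≤ 1 := by
    intro x hx h
    by_contra! hx1
    have h1 := (abs_le.1 (hout x (hsub hx) hx1.le)).2
    have h2 := mul_pos hε (hVpos x hx)
    linarith
  set r₀ := (ε * κ) ^ (b - β)⁻¹ with hr₀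
  have hr₀pos : 0 < r₀ := by positivity
  have hge : ∀ x ∈ upperHalf n hn, 1 + ε * V x ≤ u x → r₀ ≤ ‖x‖ := by
    intro x hx h
    have hx0 : 0 < ‖x‖ := norm_pos_iff.2 (hne x hx)
    have h1 := (abs_le.1 (hin x (hsub hx) (hle x hx h))).2
    have h2 := mul_le_mul_of_nonneg_left (hVκ x hx) hε.le
    have h3 : ε * κ ≤ ‖x‖ ^ (b - β) := by
      have h4 : ε * κ * ‖x‖ ^ (-b) ≤ ‖x‖ ^ (-β) := by linarith
      have h5 := mul_le_mul_of_nonneg_right h4 (Real.rpow_nonneg hx0.le b)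
      rwa [mul_assoc, ← Real.rpow_add hx0, ← Real.rpow_add hx0, neg_add_cancel, Real.rpow_zero,
        mul_one, neg_add_eq_sub] at h5
    exact (Real.rpow_inv_le_iff_of_pos (by positivity) hx0.le (by linarith)).2 h3
  refine isCompact_of_isClosed_isBounded ?_ ?_
  · refine isClosed_of_closure_subset fun x hx => ?_
    obtain ⟨y, hy, hyx⟩ := mem_closure_iff_seq_limit.1 hx
    have hxr : r₀ ≤ ‖x‖ := ge_of_tendsto' hyx.norm fun k => hge _ (hy k).1 (hy k).2
    have hx0 : x ≠ 0 := norm_pos_iff.1 (hr₀pos.trans_le hxr)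
    have hcoord : Continuous fun z : EuclideanSpace ℝ (Fin n) => z (lastIdx n hn) := by fun_prop
    have hxl : 0 ≤ x (lastIdx n hn) :=
      ge_of_tendsto' ((hcoord.tendsto x).comp hyx) fun k => le_of_lt (hy k).1
    have hux : Tendsto (fun k => u (y k)) atTop (𝓝 (u x)) :=
      (hcont x ⟨hxl, hx0⟩).tendsto.comp
        (tendsto_nhdsWithin_iff.2 ⟨hyx, Eventually.of_forall fun k => hsub (hy k).1⟩)
    have hu1 : 1 ≤ u x := ge_of_tendsto' hux fun k => by
      have := mul_pos hε (hVpos _ (hy k).1)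
      linarith [(hy k).2]
    have hxΩ : x ∈ upperHalf n hn := by
      refine lt_of_le_of_ne hxl fun h => ?_
      rw [hzero x h.symm hx0] at hu1
      linarith
    refine ⟨hxΩ, ?_⟩
    have hVx : Tendsto (fun k => V (y k)) atTop (𝓝 (V x)) :=
      ((hV.continuousAt ((isOpen_upperHalf hn).mem_nhds hxΩ)).tendsto).comp hyx
    exact le_of_tendsto_of_tendsto' ((hVx.const_mul ε).const_add 1) hux fun k => (hy k).2
  · refine (isBounded_closedBall (x := 0) (r := 1)).subset fun x hx => ?_
    rw [mem_closedBall_zero_iff]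
    exact hle x hx.1 hx.2

end

theorem mainTheorem4 (n : ℕ) (hn : 2 ≤ n) (p : ℝ) (hp : (n : ℝ) < p)
    (β : ℝ) (hβ : β < betaExp p)
    (u : EuclideanSpace ℝ (Fin n) → ℝ)
    (hcont : ContinuousOn u (closedUpperHalfPunctured n hn))
    (hnonneg : ∀ x ∈ closedUpperHalfPunctured n hn, 0 ≤ u x)
    (hharm : IsPHarmonic p (upperHalf n hn) u)
    (hzero : ∀ x : EuclideanSpace ℝ (Fin n), x (lastIdx n hn) = 0 → x ≠ 0 → u x = 0)
    (hout : ∀ x ∈ closedUpperHalfPunctured n hn, 1 ≤ ‖x‖ → |u x| ≤ 1)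
    (hin : ∀ x ∈ closedUpperHalfPunctured n hn, ‖x‖ ≤ 1 → |u x| ≤ ‖x‖ ^ (-β)) :
    ∀ x ∈ closedUpperHalfPunctured n hn, |u x| ≤ 1 := by
  intro x hx
  rw [abs_of_nonneg (hnonneg x hx)]
  rcases hx.1.eq_or_lt with h0 | hxΩ
  · rw [hzero x h0.symm hx.2]
    exact zero_le_one
  have hp2 : 2 < p := lt_of_le_of_lt (by exact_mod_cast hn) hp
  obtain ⟨b, hb, hbβ⟩ := exists_between (max_lt hβ (betaExp_pos p))
  obtain ⟨V, G, κ, hκ, hV, hG, hVG, hVeq, hVκ⟩ :=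
    exists_barrier hn hp2 ((le_max_right β 0).trans_lt hb) hbβ
  have hsub : upperHalf n hn ⊆ closedUpperHalfPunctured n hn := fun y hy =>
    ⟨le_of_lt hy, by
      rintro rfl
      exact lt_irrefl _ (show (0 : ℝ) < (0 : EuclideanSpace ℝ (Fin n)) (lastIdx n hn) from hy)⟩
  have key : ∀ ε > 0, u x ≤ 1 + ε * V x := fun ε hε =>
    hharm.le_of_isCompact (by omega) (isOpen_upperHalf hn) hp2
      (IsPHarmonic.one_add_mul hε hV hG hVG hVeq) (hcont.mono hsub)
      (continuousOn_const.add (hV.const_mul ε))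
      (isCompact_contact_set hn ((le_max_left β 0).trans_lt hb) hκ hε hcont hzero hout hin hV hVκ)
      x hxΩ
  have hlim : Filter.Tendsto (fun ε : ℝ => 1 + ε * V x) (nhdsWithin 0 (Set.Ioi 0)) (nhds 1) := by
    have : Continuous fun ε : ℝ => 1 + ε * V x := by fun_prop
    have h := this.tendsto 0
    simp only [zero_mul, add_zero] at h
    exact h.mono_left nhdsWithin_le_nhds
  exact ge_of_tendsto hlim (Filter.eventually_of_mem self_mem_nhdsWithin fun ε hε => key ε hε)
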